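/- All graphs are finite and simple. For graphs $H$ and $G$ write $H\le G$ if $H$ is isomorphic to an induced subgraph of $G$; $G$ is $(H_1,H_2)$-free if neither $H_1\le G$ nor $H_2\le G$. Let $P_2\cup P_4$ be the disjoint union of paths on $2$ and $4$ vertices, and let the paw be the triangle with one pendant edge. Let $F_1$ be the Mycielski--Gr\"otzsch graph (the Mycielski graph of the $5$-cycle, on $11$ vertices) and let $F_2$ be the Clebsch graph (the $5$-regular graph on $16$ vertices obtained from the $4$-dimensional cube by joining all pairs of antipodal vertices). A comparable pair of $G$ is a pair $(u,v)$ of distinct nonadjacent vertices with $N(u)\subseteq N(v)$. There is a deterministic algorithm $A$, whose running time on every graph is bounded by a polynomial in the number of vertices, such that the following holds. Let $G$ be a connected $(P_2\cup P_4,\text{paw})$-free graph. Then at least one of the following holds: (i) $G$ has a comparable pair; (ii) $G$ is a complete graph; (iii) $F_1\le G$ and $G\le F_2$, and $\chi(G)=4$; (iv) $\chi(G)\le 3$, and $A$ computes a proper $3$-coloring of $G$. Moreover, $A$ computes a proper $3$-coloring of every connected $(P_2\cup P_4,\text{paw})$-free graph $G$ with $\chi(G)\le 3$ (whether or not (i)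 or (ii) also holds). Here algorithms are programs of a random access machine (registers, arrays, addition, truncated subtraction, branching on zero and loops, each at unit cost; no multiplication), whose input is the number of vertices and the adjacency matrix of $G$ for an arbitrary numbering of the vertices. -/

import Mathlib

namespace SimpleGraph

/-- `P₂ ∪ P₄`: the disjoint union of a path on 2 vertices and a path on 4 vertices. -/
abbrev P2UnionP4 : SimpleGraph (Fin 2 ⊕ Fin 4) := pathGraph 2 ⊕g pathGraph 4

/-- The paw: a triangle `0, 1, 2` with a pendant edge `0 3`. -/
def paw : SimpleGraph (Fin 4) := fromEdgeSet {s(0, 1), s(1, 2), s(0, 2), s(0, 3)}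

/-- The Mycielski graph of `G`: a copy `some (inl v)` of each vertex, a shadow `some (inr v)`
adjacent to the neighbours of `v`, and an apex `none` adjacent to all the shadows. -/
def mycielskian {V : Type*} (G : SimpleGraph V) : SimpleGraph (Option (V ⊕ V)) where
  Adj
    | some (.inl u), some (.inl v) => G.Adj u v
    | some (.inl u), some (.inr v) => G.Adj u v
    | some (.inr u), some (.inl v) => G.Adj u v
    | some (.inr _), none => True
    | none, some (.inr _) => True
    | _, _ => False
  symm := ⟨by
    rintro (_ | _ | u) (_ | _ | v) h <;> first | exact h.symm | exact h⟩
  loopless := ⟨by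
    rintro (_ | _ | u) h <;> first | exact h | exact G.irrefl h⟩

/-- `F₁`: the Mycielski–Grötzsch graph, on 11 vertices. -/
abbrev groetzsch : SimpleGraph (Option (Fin 5 ⊕ Fin 5)) := mycielskian (cycleGraph 5)

/-- `F₂`: the (5-regular, triangle-free) Clebsch graph on 16 vertices, that is the 4-cube with
its pairs of antipodal vertices joined. -/
def clebsch : SimpleGraph (Fin 4 → Bool) where
  Adj x y := hammingDist x y = 1 ∨ hammingDist x y = 4
  symm := ⟨fun x y h => by rwa [hammingDist_comm y x]⟩
  loopless := ⟨fun x h => by simp at h⟩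

/-- `G` has a comparable pair: distinct nonadjacent vertices `u`, `v` with `N(u) ⊆ N(v)`. -/
def HasComparablePair {V : Type*} (G : SimpleGraph V) : Prop :=
  ∃ u v : V, u ≠ v ∧ ¬ G.Adj u v ∧ G.neighborSet u ⊆ G.neighborSet v

end SimpleGraph

/-! Algorithms: programs of a random access machine with addition and truncated subtraction as
its only arithmetic (no multiplication), at unit cost. In `t` steps such a machine produces numbers
of `O(t)` bits only (for a fixed program and inputs of the kind used below), so that its polynomial
time is that of Turing machines. -/
namespace RAM

/-- The memory of the machine: registers `x₀, x₁, …` and arrays `a₀, a₁, …`, holding naturals. -/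
structure Store where
  reg : ℕ → ℕ
  arr : ℕ → ℕ → ℕ

/-- Expressions: constants, registers, array cells `aₖ[e]`, sums and truncated differences. -/
inductive Exp where
  | const (c : ℕ)
  | reg (x : ℕ)
  | cell (k : ℕ) (e : Exp)
  | add (e₁ e₂ : Exp)
  | sub (e₁ e₂ : Exp)

/-- The value of an expression. -/
def Exp.eval (s : Store) : Exp → ℕ
  | .const c => c
  | .reg x => s.reg x
  | .cell k e => s.arr k (e.eval s)
  | .add e₁ e₂ => e₁.eval s + e₂.eval s
  | .sub e₁ e₂ => e₁.eval s - e₂.eval s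

/-- The number of steps that it takes to evaluate an expression: one for every operation and
every access to the memory. -/
def Exp.cost : Exp → ℕ
  | .const _ => 1
  | .reg _ => 1
  | .cell _ e => e.cost + 1
  | .add e₁ e₂ => e₁.cost + e₂.cost + 1
  | .sub e₁ e₂ => e₁.cost + e₂.cost + 1

/-- Programs: `set x e` is `xₓ := e`, `put k i e` is `aₖ[i] := e`, `ite e p q` runs `p` if `e` is
nonzero and `q` otherwise, and `loop e p` runs `p` as long as `e` is nonzero. -/
inductive Program where
  | skip
  | set (x : ℕ) (e : Exp)
  | put (k : ℕ) (i e : Exp)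
  | seq (p q : Program)
  | ite (e : Exp) (p q : Program)
  | loop (e : Exp) (p : Program)

/-- `Exec p s t s'`: started on the memory `s`, the program `p` halts after exactly `t` steps, and
`s'` is the memory then. -/
inductive Exec : Program → Store → ℕ → Store → Prop
  | skip (s : Store) : Exec .skip s 1 s
  | set (x : ℕ) (e : Exp) (s : Store) :
      Exec (.set x e) s (e.cost + 1) ⟨Function.update s.reg x (e.eval s), s.arr⟩
  | put (k : ℕ) (i e : Exp) (s : Store) :
      Exec (.put k i e) s (i.cost + e.cost + 1)
        ⟨s.reg, Function.update s.arr k (Function.update (s.arr k) (i.eval s) (e.eval s))⟩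
  | seq {p q : Program} {s s₁ s₂ : Store} {t₁ t₂ : ℕ} :
      Exec p s t₁ s₁ → Exec q s₁ t₂ s₂ → Exec (.seq p q) s (t₁ + t₂) s₂
  | ite_true {e : Exp} {p q : Program} {s s₁ : Store} {t : ℕ} :
      e.eval s ≠ 0 → Exec p s t s₁ → Exec (.ite e p q) s (e.cost + 1 + t) s₁
  | ite_false {e : Exp} {p q : Program} {s s₁ : Store} {t : ℕ} :
      e.eval s = 0 → Exec q s t s₁ → Exec (.ite e p q) s (e.cost + 1 + t) s₁
  | loop_stop {e : Exp} {p : Program} {s : Store} :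
      e.eval s = 0 → Exec (.loop e p) s (e.cost + 1) s
  | loop_step {e : Exp} {p : Program} {s s₁ s₂ : Store} {t₁ t₂ : ℕ} :
      e.eval s ≠ 0 → Exec p s t₁ s₁ → Exec (.loop e p) s₁ t₂ s₂ →
        Exec (.loop e p) s (e.cost + 1 + t₁ + t₂) s₂

/-- The machine is deterministic. -/
theorem Exec.det {p : Program} {s s₁ s₂ : Store} {t₁ t₂ : ℕ}
    (h₁ : Exec p s t₁ s₁) (h₂ : Exec p s t₂ s₂) : t₁ = t₂ ∧ s₁ = s₂ := by
  induction h₁ generalizing t₂ s₂ with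
  | skip s => cases h₂; exact ⟨rfl, rfl⟩
  | set x e s => cases h₂; exact ⟨rfl, rfl⟩
  | put k i e s => cases h₂; exact ⟨rfl, rfl⟩
  | seq _ _ ih₁ ih₂ =>
    cases h₂ with
    | seq a b =>
      obtain ⟨rfl, rfl⟩ := ih₁ a
      obtain ⟨rfl, rfl⟩ := ih₂ b
      exact ⟨rfl, rfl⟩
  | ite_true h _ ih =>
    cases h₂ with
    | ite_true _ a => obtain ⟨rfl, rfl⟩ := ih a; exact ⟨rfl, rfl⟩
    | ite_false h' _ => exact absurd h' h
  | ite_false h _ ih =>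
    cases h₂ with
    | ite_true h' _ => exact absurd h h'
    | ite_false _ a => obtain ⟨rfl, rfl⟩ := ih a; exact ⟨rfl, rfl⟩
  | loop_stop h =>
    cases h₂ with
    | loop_stop _ => exact ⟨rfl, rfl⟩
    | loop_step h' _ _ => exact absurd h h'
  | loop_step h _ _ ih₁ ih₂ =>
    cases h₂ with
    | loop_stop h' => exact absurd h' h
    | loop_step _ a b =>
      obtain ⟨rfl, rfl⟩ := ih₁ a
      obtain ⟨rfl, rfl⟩ := ih₂ b
      exact ⟨rfl, rfl⟩

open Classical in
/-- The input of a graph on `0, …, n - 1`: the number `n` in register `0`, the adjacency matrix,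
row by row, in array `0`, and zeros elsewhere. -/
noncomputable def input {n : ℕ} (G : SimpleGraph (Fin n)) : Store where
  reg x := if x = 0 then n else 0
  arr k m := if k = 0 ∧ ∃ i j : Fin n, m = n * i + j ∧ G.Adj i j then 1 else 0

/-- `p` is a polynomial-time graph algorithm: on every graph it halts, within a number of steps
that is bounded by a polynomial in the number of vertices. -/
def Program.PolyTime (p : Program) : Prop :=
  ∃ b : Polynomial ℕ, ∀ (n : ℕ) (G : SimpleGraph (Fin n)),
    ∃ (t : ℕ) (s : Store), Exec p (input G) t s ∧ t ≤ b.eval n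

/-- `p` determines a `k`-coloring of `G`: for every numbering `e` of the vertices by
`0, …, n - 1`, the program halts on the resulting input, and array `1` then holds the colors of a
proper coloring of `G` with the colors `0, …, k - 1`. -/
def Program.Colors (p : Program) (k : ℕ) {V : Type*} (G : SimpleGraph V) : Prop :=
  ∀ (n : ℕ) (e : Fin n ≃ V), ∃ (t : ℕ) (s : Store), Exec p (input (G.comap e)) t s ∧
    ∃ c : G.Coloring (Fin k), ∀ i : Fin n, s.arr 1 i = c (e i)

end RAM

/-! Suppose first that `G` has a triangle. Connectivity and paw-freeness make nonadjacency
transitive (`not_adj_trans`), so `G` is complete multipartite. Two vertices of one class form a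
comparable pair; if there are none, `G` is complete. If `G` is 3-colorable, it is complete
tripartite.

Suppose now that `G` is triangle-free, and fix a vertex `x`. If the vertices outside `N(x)` induce a
bipartite graph, the independent set `N(x)` is a third color class. Otherwise they contain a
shortest odd cycle, of length 5 or 7, since a longer one contains `P₂ ∪ P₄`. A neighbor `t` of `x`
excludes length 7, and on a 5-cycle it has exactly two, nonadjacent, neighbors. From these seven
vertices a finite case distinction on the types (adjacency patterns to the vertices chosen so far)
of the remaining vertices yields an induced Grötzsch graph, or vertices `a`, `b`, `c` whose majority
set is independent with bipartite complement (`Splits`). The kernel verifies it (`typeTree_check`,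
`TypeTree.check_sound`).

Over an induced Grötzsch graph, types determine adjacency, and they do so as in the Clebsch graph
(`groetzschTypes_check`). Vertices of equal type are twins, so without comparable pairs `G` embeds
into the Clebsch graph. Since the Grötzsch graph is not 3-colorable and the Clebsch graph is
4-colorable, `χ(G) = 4`.

In every 3-colorable case some triple satisfies `Splits`; for a complete tripartite graph any
triangle does. The algorithm tries all triples, colors the complement of the majority set by
propagation, and keeps a result only after checking it (`attemptCmd_run`, `colors_of_splits`). -/

namespace SimpleGraph

variable {V : Type*} {G : SimpleGraph V}

/-! ### Excluded subgraphs as adjacency conditions -/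

/-- The graphs without triangles and induced `P₂ ∪ P₄`, in terms of adjacencies. -/
structure IsTriangleP2P4Free (G : SimpleGraph V) : Prop where
  tri : ∀ {a b c}, G.Adj a b → G.Adj b c → ¬ G.Adj a c
  p2p4 : ∀ {a b p c d q}, G.Adj a b → G.Adj p c → G.Adj c d → G.Adj d q → ¬ G.Adj p q →
    ¬ G.Adj a p → ¬ G.Adj a c → ¬ G.Adj a d → ¬ G.Adj a q →
    ¬ G.Adj b p → ¬ G.Adj b c → ¬ G.Adj b d → ¬ G.Adj b q → False

/-- A copy of a graph without twins is found by its adjacencies alone. -/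
theorem isIndContained_of_adj_iff {W : Type*} {H : SimpleGraph W}
    (hH : ∀ u v, (∀ w, H.Adj u w ↔ H.Adj v w) → u = v) (f : W → V)
    (h : ∀ u v, G.Adj (f u) (f v) ↔ H.Adj u v) : H.IsIndContained G :=
  ⟨⟨⟨f, fun u v huv => hH u v fun w => by rw [← h, ← h, huv]⟩, h _ _⟩⟩

theorem isTriangleP2P4Free_of_not_isIndContained
    (htri : ∀ {a b c}, G.Adj a b → G.Adj b c → ¬ G.Adj a c)
    (h : ¬ P2UnionP4.IsIndContained G) : G.IsTriangleP2P4Free := by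
  refine ⟨htri, fun {a b p c d q} hab hpc hcd hdq hpq hap hac had haq hbp hbc hbd hbq => h ?_⟩
  -- These two nonadjacencies are absent from `p2p4`, because triangle-freeness supplies them.
  have hpd := htri hpc hcd
  have hcq := htri hcd hdq
  refine isIndContained_of_adj_iff (by simp only [pathGraph_adj, Sum.forall, sum_adj]; decide)
    (Sum.elim ![a, b] ![p, c, d, q]) ?_
  have hsymm : ∀ {x y}, ¬ G.Adj x y → ¬ G.Adj y x := fun h => mt (G.adj_symm ·) h
  rintro (u | u) (v | v) <;> fin_cases u <;> fin_cases v <;>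
    simp [pathGraph_adj, hab, hpc, hcd, hdq, hpq, hap, hac, had, haq, hbp, hbc, hbd, hbq, hpd,
      hcq, hab.symm, hpc.symm, hcd.symm, hdq.symm, hsymm hpq, hsymm hap, hsymm hac, hsymm had,
      hsymm haq, hsymm hbp, hsymm hbc, hsymm hbd, hsymm hbq, hsymm hpd, hsymm hcq]

/-! ### Types of vertices over a list, encoded in binary, and the search for excluded subgraphs -/

open Classical in
/-- The adjacencies of `v` to the vertices of a list, as the bits of a number. -/
noncomputable def adjCode (G : SimpleGraph V) : List V → V → ℕ
  | [], _ => 0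
  | w :: l, v => 2 * adjCode G l v + if G.Adj v w then 1 else 0

theorem testBit_adjCode {l : List V} {v : V} {i : ℕ} :
    (G.adjCode l v).testBit i = true ↔ ∃ w, l[i]? = some w ∧ G.Adj v w := by
  induction l generalizing i with
  | nil => simp [adjCode]
  | cons w l ih =>
    cases i with
    | zero => by_cases h : G.Adj v w <;> simp [adjCode, h, Nat.testBit_zero, Nat.add_mod]
    | succ i =>
      have : (G.adjCode (w :: l) v) / 2 = G.adjCode l v := by
        simp only [adjCode]; split_ifs <;> omega
      rw [Nat.testBit_succ, this, ih]; simp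

/-- Adds a bit of `m` to each of the rows. -/
def extendRows : List ℕ → ℕ → List ℕ
  | [], _ => []
  | r :: g, m => (2 * r + m % 2) :: extendRows g (m / 2)

/-- Adds a vertex with neighbors `m` to the graph with adjacency rows `g`. -/
def addVertex (g : List ℕ) (m : ℕ) : List ℕ := 2 * m :: extendRows g m

/-- The rows selected by the bits of `m`. -/
def selectRows : List ℕ → ℕ → List ℕ
  | [], _ => []
  | r :: g, m => if m % 2 = 1 then r :: selectRows g (m / 2) else selectRows g (m / 2)

/-- Searches for an induced `P₄` among the vertices `M` of a triangle-free graph. -/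
def hasP4 (g : List ℕ) (M : ℕ) : Bool :=
  ((selectRows g M).map (· &&& M)).any fun p => ((selectRows g M).map (· &&& M)).any fun d =>
    (p &&& d != 0) && (p &&& d != d)

/-- Searches for an induced `P₂ ∪ P₄` with an edge joining the rows `a` and `b`. -/
def edgeClash (g : List ℕ) (a b : ℕ) : Bool := hasP4 g ((2 ^ g.length - 1) ^^^ (a ||| b))

/-- Searches for an induced `P₂ ∪ P₄` that contains the first two vertices. -/
def clash : List ℕ → Bool
  | u :: w :: r =>
    ((selectRows (u :: w :: r) u).any fun b => edgeClash (u :: w :: r) u b) ||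
    ((selectRows (u :: w :: r) w).any fun b => edgeClash (u :: w :: r) w b) ||
    r.any fun a => (a % 4 == 0) &&
      (selectRows (u :: w :: r) a).any fun b => (b % 4 == 0) && edgeClash (u :: w :: r) a b
  | _ => false

theorem mem_selectRows {g : List ℕ} {m r : ℕ} :
    r ∈ selectRows g m ↔ ∃ i, m.testBit i = true ∧ g[i]? = some r := by
  induction g generalizing m with
  | nil => simp [selectRows]
  | cons s g ih =>
    have key : (∃ i, m.testBit i = true ∧ (s :: g)[i]? = some r) ↔
        (m % 2 = 1 ∧ s = r) ∨ ∃ i, (m / 2).testBit i = true ∧ g[i]? = some r := by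
      constructor
      · rintro ⟨_ | i, h1, h2⟩
        · left; simpa [Nat.testBit_zero] using And.intro h1 h2
        · right; exact ⟨i, by rwa [Nat.testBit_succ] at h1, by simpa using h2⟩
      · rintro (⟨h1, h2⟩ | ⟨i, h1, h2⟩)
        · exact ⟨0, by simp [Nat.testBit_zero, h1], by simp [h2]⟩
        · exact ⟨i + 1, by rwa [Nat.testBit_succ], by simpa using h2⟩
    rw [key, selectRows]
    split_ifs with h
    · rw [List.mem_cons, ih, and_iff_right h, eq_comm]
    · rw [ih, iff_or_self]; exact fun h' => absurd h'.1 h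

theorem extendRows_map (l L : List V) (w : V) :
    extendRows (L.map (G.adjCode l)) (G.adjCode L w) = L.map (G.adjCode (w :: l)) := by
  classical
  induction L with
  | nil => rfl
  | cons v L ih =>
    have h1 : G.adjCode (v :: L) w / 2 = G.adjCode L w := by
      simp only [adjCode]; split_ifs <;> omega
    have h2 : G.adjCode (v :: L) w % 2 = if G.Adj v w then 1 else 0 := by
      simp only [adjCode, G.adj_comm w v]; split_ifs <;> omega
    simp only [List.map_cons, extendRows, h1, h2, ih]
    congr 1

theorem addVertex_map (l : List V) (w : V) :
    addVertex (l.map (G.adjCode l)) (G.adjCode l w) = (w :: l).map (G.adjCode (w :: l)) := by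
  simp [addVertex, extendRows_map, adjCode]

/-- A hit of `hasP4` is a pair `p`, `d` with a common neighbor `c` and a neighbor `q` of `d` that is
not one of `p`, all of them nonadjacent to both ends of the edge. Then `p c d q` is a path, and
triangle-freeness makes it induced. -/
theorem IsTriangleP2P4Free.edgeClash_eq_false (hG : G.IsTriangleP2P4Free) {l : List V} {v w : V}
    (h : G.Adj v w) :
    edgeClash (l.map (G.adjCode l)) (G.adjCode l v) (G.adjCode l w) = false := by
  rw [Bool.eq_false_iff]
  intro hc
  simp only [edgeClash, hasP4, List.any_eq_true, List.mem_map, mem_selectRows,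
    List.getElem?_map, Option.map_eq_some_iff, Bool.and_eq_true, bne_iff_ne] at hc
  -- The bits of `M` mark the positions of the list that are adjacent to neither end of the edge.
  set M := (2 ^ (l.map (G.adjCode l)).length - 1) ^^^ (G.adjCode l v ||| G.adjCode l w) with hM
  have key : ∀ i x, M.testBit i = true → l[i]? = some x → ¬ G.Adj v x ∧ ¬ G.Adj w x := by
    intro i x hi hx
    have hil : i < l.length := (List.getElem?_eq_some_iff.1 hx).1
    rw [hM, Nat.testBit_xor, Nat.testBit_two_pow_sub_one, Nat.testBit_or] at hi
    simp only [List.length_map, hil, decide_true, Bool.true_bne, Bool.not_eq_true',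
      Bool.or_eq_false_iff] at hi
    constructor
    · intro hv
      have := testBit_adjCode.2 ⟨x, hx, hv⟩
      simp [this] at hi
    · intro hv
      have := testBit_adjCode.2 ⟨x, hx, hv⟩
      simp [this] at hi
  obtain ⟨_, ⟨_, ⟨i, hi, p, hp, rfl⟩, rfl⟩, _, ⟨_, ⟨j, hj, d, hd, rfl⟩, rfl⟩, h1, h2⟩ := hc
  obtain ⟨k, hk⟩ := Nat.exists_testBit_of_ne_zero h1
  obtain ⟨m, hm⟩ := Nat.exists_testBit_ne_of_ne h2
  simp only [Nat.testBit_and, Bool.and_eq_true] at hk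
  obtain ⟨⟨hk1, hk2⟩, hk3, -⟩ := hk
  have hm' : (G.adjCode l d).testBit m = true ∧ M.testBit m = true ∧
      ¬ (G.adjCode l p).testBit m = true := by
    simp only [Nat.testBit_and] at hm
    revert hm
    cases (G.adjCode l d).testBit m <;> cases (G.adjCode l p).testBit m <;>
      cases M.testBit m <;> simp
  obtain ⟨hm1, hm2, hm3⟩ := hm'
  obtain ⟨c, hc, hpc⟩ := testBit_adjCode.1 hk1
  obtain ⟨c', hc', hdc⟩ := testBit_adjCode.1 hk3
  obtain ⟨q, hq, hdq⟩ := testBit_adjCode.1 hm1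
  have hcc : c' = c := by rw [hc] at hc'; exact (Option.some.inj hc').symm
  subst hcc
  have hpq : ¬ G.Adj p q := fun h => hm3 (testBit_adjCode.2 ⟨q, hq, h⟩)
  have k1 := key i p hi hp
  have k2 := key k c' hk2 hc
  have k3 := key j d hj hd
  have k4 := key m q hm2 hq
  exact hG.p2p4 h hpc hdc.symm hdq hpq k1.1 k2.1 k3.1 k4.1 k1.2 k2.2 k3.2 k4.2

theorem mem_selectRows_map {l : List V} {v : V} {r : ℕ}
    (h : r ∈ selectRows (l.map (G.adjCode l)) (G.adjCode l v)) :
    ∃ w, G.Adj v w ∧ r = G.adjCode l w := by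
  obtain ⟨i, hi, hr⟩ := mem_selectRows.1 h
  obtain ⟨w, hw, hvw⟩ := testBit_adjCode.1 hi
  rw [List.getElem?_map, hw] at hr
  exact ⟨w, hvw, (Option.some.inj hr).symm⟩

/-- Only soundness of the search is needed: restricting it to copies through the two newest vertices
affects its strength, not its validity. The list may repeat vertices, because the excluded
configurations are given by adjacencies alone. -/
theorem IsTriangleP2P4Free.clash_eq_false (hG : G.IsTriangleP2P4Free) (l : List V) :
    clash (l.map (G.adjCode l)) = false := by
  have aux : ∀ (L : List V) (v : V) (b : ℕ),
      b ∈ selectRows (L.map (G.adjCode L)) (G.adjCode L v) →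
      edgeClash (L.map (G.adjCode L)) (G.adjCode L v) b = false := by
    intro L v b hb
    obtain ⟨w, hw, rfl⟩ := mem_selectRows_map hb
    exact hG.edgeClash_eq_false hw
  match l with
  | [] => rfl
  | [_] => rfl
  | u :: w :: r =>
    have aux := aux (u :: w :: r)
    simp only [List.map_cons] at aux ⊢
    simp only [clash, Bool.or_eq_false_iff, List.any_eq_false, Bool.and_eq_true, not_and,
      Bool.not_eq_true]
    refine ⟨⟨fun b hb => by simp [aux u b hb], fun b hb => by simp [aux w b hb]⟩,
      fun a ha _ b hb _ => ?_⟩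
    obtain ⟨x, -, rfl⟩ := List.mem_map.1 ha
    simp [aux x b hb]

/-- A vertex of type `t`, added to the rows `g`, yields a triangle or an induced `P₂ ∪ P₄`
that contains it and the first vertex. -/
def isBadType (g : List ℕ) (t : ℕ) : Bool :=
  ((t % 2 == 1) && (t &&& g.headD 0 != 0)) || clash (addVertex g t)

theorem IsTriangleP2P4Free.and_eq_zero (hG : G.IsTriangleP2P4Free) {l : List V} {v w : V}
    (h : G.Adj v w) : G.adjCode l v &&& G.adjCode l w = 0 := by
  refine Nat.eq_of_testBit_eq fun i => ?_
  rw [Nat.zero_testBit, Bool.eq_false_iff, Nat.testBit_and]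
  intro hi
  rw [Bool.and_eq_true] at hi
  obtain ⟨x, hx, h1⟩ := testBit_adjCode.1 hi.1
  obtain ⟨y, hy, h2⟩ := testBit_adjCode.1 hi.2
  rw [hx] at hy
  obtain rfl := Option.some.inj hy
  exact hG.tri h h2 h1

theorem IsTriangleP2P4Free.isBadType_eq_false (hG : G.IsTriangleP2P4Free) (l : List V) (v : V) :
    isBadType (l.map (G.adjCode l)) (G.adjCode l v) = false := by
  rw [isBadType, addVertex_map, hG.clash_eq_false, Bool.or_false]
  cases l with
  | nil => simp
  | cons w l =>
    by_cases h : G.Adj v w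
    · simp only [List.map_cons, List.headD_cons, hG.and_eq_zero h]; simp
    · simp [adjCode, h]

/-- The possible types over the graph `g` with a vertex of type `m` added. -/
def growTypes (g ts : List ℕ) (m : ℕ) : List ℕ :=
  (ts.flatMap fun t => [2 * t, 2 * t + 1]).filter fun t => !isBadType (addVertex g m) t

/-- The types over `l` are in `ts`, and `g` are the types of the members of `l`. -/
structure Typed (G : SimpleGraph V) (l : List V) (g ts : List ℕ) : Prop where
  rows : g = l.map (G.adjCode l)
  mem : ∀ v, G.adjCode l v ∈ ts

theorem typed_nil : G.Typed [] [] [0] := ⟨rfl, fun _ => by simp [adjCode]⟩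

/-- The newest vertex is the head of the list and hence bit `0`, so each old type `t` becomes `2 *
t` or `2 * t + 1`; those that create an excluded subgraph are discarded. -/
theorem Typed.cons (hG : G.IsTriangleP2P4Free) {l : List V} {g ts : List ℕ} (h : G.Typed l g ts)
    {w : V} {m : ℕ} (hw : G.adjCode l w = m) :
    G.Typed (w :: l) (addVertex g m) (growTypes g ts m) := by
  obtain ⟨rfl, hts⟩ := h
  subst hw
  refine ⟨addVertex_map l w, fun v => ?_⟩
  rw [growTypes, List.mem_filter, addVertex_map, hG.isBadType_eq_false]
  refine ⟨List.mem_flatMap.2 ⟨_, hts v, ?_⟩, rfl⟩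
  by_cases h : G.Adj v w <;> simp [adjCode, h]

/-- Vertices of types `s` and `t` over `g` cannot be adjacent. -/
def neverAdj (g : List ℕ) (s t : ℕ) : Bool :=
  (s &&& t != 0) || clash (addVertex (addVertex g s) (2 * t + 1))

theorem Typed.not_adj (hG : G.IsTriangleP2P4Free) {l : List V} {g ts : List ℕ}
    (h : G.Typed l g ts) {v w : V} (hvw : neverAdj g (G.adjCode l v) (G.adjCode l w) = true) :
    ¬ G.Adj v w := by
  intro hadj
  obtain ⟨rfl, -⟩ := h
  have h1 : 2 * G.adjCode l w + 1 = G.adjCode (v :: l) w := by simp [adjCode, hadj.symm]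
  rw [neverAdj, hG.and_eq_zero hadj, addVertex_map, h1, addVertex_map, hG.clash_eq_false] at hvw
  simp at hvw

/-- Vertices of types `s` and `t` over `g` cannot be nonadjacent. -/
def alwaysAdj (g : List ℕ) (s t : ℕ) : Bool := clash (addVertex (addVertex g s) (2 * t))

/-- If `v` and `w` were nonadjacent, the rows with both added would be those of an actual list of
vertices, in which no clash exists. The case `v = w` needs no separate treatment, since lists may
repeat vertices. -/
theorem Typed.adj (hG : G.IsTriangleP2P4Free) {l : List V} {g ts : List ℕ}
    (h : G.Typed l g ts) {v w : V} (hvw : alwaysAdj g (G.adjCode l v) (G.adjCode l w) = true) :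
    G.Adj v w := by
  by_contra hadj
  obtain ⟨rfl, -⟩ := h
  have h1 : 2 * G.adjCode l w = G.adjCode (v :: l) w := by simp [adjCode, G.adj_comm w v, hadj]
  rw [alwaysAdj, addVertex_map, h1, addVertex_map, hG.clash_eq_false] at hvw
  simp at hvw

/-! ### Majority sets and the verified case distinction -/

/-- `w` has more neighbors among `a`, `b` than among `c`. -/
def InMajority (G : SimpleGraph V) (a b c w : V) : Prop :=
  (G.Adj a w ∧ G.Adj b w) ∨ ((G.Adj a w ∨ G.Adj b w) ∧ ¬ G.Adj c w)

/-- The vertices in the majority set of `a`, `b`, `c` are independent, and the others induce a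
bipartite graph. -/
def Splits (G : SimpleGraph V) (a b c : V) : Prop :=
  ∃ f : V → Bool, ∀ v w, G.Adj v w → ¬ (G.InMajority a b c v ∧ G.InMajority a b c w) ∧
    (¬ G.InMajority a b c v → ¬ G.InMajority a b c w → f v ≠ f w)

/-- A case distinction on the types of the vertices that occur. -/
inductive TypeTree where
  /-- the `a`-th, `b`-th and `c`-th vertex split the graph, with the bipartition `k` of the types -/
  | color (a b c k : ℕ)
  /-- the vertices with these indices induce the Grötzsch graph -/
  | obstruction (idx : List ℕ)
  /-- is there a vertex of type `m`? -/
  | split (m : ℕ) (p q : TypeTree)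

/-- Whether the vertices of type `t` are in the majority set of the `a`-th, `b`-th and `c`-th. -/
def inMajorityType (a b c t : ℕ) : Bool :=
  (t.testBit a && t.testBit b) || ((t.testBit a || t.testBit b) && !t.testBit c)

/-- The types with their colors. -/
def colorTypes (a b c : ℕ) : List ℕ → ℕ → List (ℕ × ℕ)
  | [], _ => []
  | t :: ts, k => (t, if inMajorityType a b c t then 2 else k % 2) :: colorTypes a b c ts (k / 2)

/-- The adjacency rows of the Grötzsch graph: the cycle, the apex, the shadows. -/
def groetzschRows : List ℕ := [1170, 325, 650, 1300, 585, 1984, 50, 37, 42, 52, 41]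

/-- The position of a vertex of the Grötzsch graph in `groetzschRows`. -/
def groetzschIndex : Option (Fin 5 ⊕ Fin 5) → Fin 11
  | some (.inl i) => i.castLE (by omega)
  | none => 5
  | some (.inr i) => (i.natAdd 6)

/-- Verifies a case distinction. -/
def TypeTree.check : TypeTree → List ℕ → List ℕ → Bool
  | .color a b c k, g, ts =>
    Nat.blt a g.length && Nat.blt b g.length && Nat.blt c g.length &&
    (colorTypes a b c ts k).all fun p => (colorTypes a b c ts k).all fun q =>
      p.2 != q.2 || neverAdj g p.1 q.1
  | .obstruction idx, g, _ => (List.range 11).all fun i => Nat.blt (idx.getD i 0) g.length &&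
      (List.range 11).all fun j =>
        (g.getD (idx.getD i 0) 0).testBit (idx.getD j 0) == (groetzschRows.getD i 0).testBit j
  | .split m p q, g, ts =>
    p.check (addVertex g m) (growTypes g ts m) && q.check g (ts.filter fun t => t != m)

/-- The types over a 5-cycle `v₀ … v₄`, a vertex `x` that has no neighbors on it, and a
neighbor of `x`, `v₁` and `v₄`, added in this order. -/
def startRows : List ℕ := [0, 1, 1, 1, 9, 0, 19].foldl addVertex []

/-- The possible types over `startRows`. -/
def startTypes : List ℕ :=
  ([0, 1, 1, 1, 9, 0, 19].foldl (fun s m => (addVertex s.1 m, growTypes s.1 s.2 m)) ([], [0])).2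

/-- The case distinction that proves the structure theorem. -/
def typeTree : TypeTree :=
  .split 74 (.split 44 (.split 70 (.split 262 (.obstruction [2, 6, 4, 9, 8, 3, 7, 5, 10, 1, 0])
  (.split 656 (.obstruction [3, 5, 4, 6, 10, 8, 0, 1, 2, 9, 7]) (.split 336 (.split 1031 (.split
  134 (.obstruction [1, 2, 7, 5, 3, 8, 0, 4, 9, 6, 12]) (.split 289 (.obstruction [1, 2, 9, 5, 12,
  6, 11, 0, 7, 8, 3]) (.color 0 7 4 3712))) (.color 4 4 4 5632)) (.color 0 0 0 224)))) (.split
  131 (.split 336 (.obstruction [2, 5, 3, 7, 6, 9, 4, 1, 0, 10, 8]) (.split 73 (.split 1313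
  (.split 133 (.obstruction [1, 2, 3, 5, 7, 8, 6, 0, 9, 4, 12]) (.split 2058 (.obstruction [1, 2, 6,
  11, 12, 4, 0, 7, 3, 8, 10]) (.color 0 3 4 7184))) (.color 1 1 1 400)) (.color 1 1 1 14336)))
  (.split 168 (.split 656 (.obstruction [6, 7, 8, 9, 10, 5, 3, 2, 1, 0, 4]) (.color 0 0 0 224))
  (.color 4 4 4 15872)))) (.split 164 (.split 37 (.split 140 (.obstruction [2, 8, 7, 3, 10, 4, 9,
  1, 0, 6, 5]) (.split 336 (.obstruction [2, 5, 4, 9, 10, 7, 3, 1, 0, 6, 8]) (.color 0 0 0 7168)))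
  (.split 17 (.split 141 (.split 674 (.split 1044 (.obstruction [1, 3, 4, 10, 11, 5, 0, 7, 2, 12,
  9]) (.split 2051 (.obstruction [1, 3, 2, 6, 7, 12, 4, 0, 8, 5, 11]) (.color 0 4 3 5888)))
  (.color 0 0 0 13312)) (.color 8 8 8 11264)) (.color 1 1 1 13824))) (.split 35 (.split 160
  (.color 2 2 2 3840) (.split 168 (.split 35 (.split 521 (.obstruction [1, 2, 10, 5, 7, 4, 8, 0,
  6, 11, 3]) (.split 1030 (.obstruction [2, 8, 7, 11, 10, 3, 9, 1, 4, 5, 0]) (.color 4 4 4 2816)))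
  (.split 515 (.split 145 (.obstruction [1, 2, 8, 4, 11, 5, 10, 0, 6, 7, 3]) (.color 3 3 3 5632))
  (.color 2 2 2 1792))) (.color 0 0 0 224))) (.color 4 4 4 224)))) (.split 82 (.split 84 (.split
  19 (.split 76 (.obstruction [2, 7, 6, 4, 9, 3, 8, 1, 0, 10, 5]) (.split 176 (.obstruction [2, 5,
  3, 8, 9, 6, 4, 1, 0, 10, 7]) (.color 0 0 0 448))) (.split 38 (.split 176 (.split 1031 (.split
  545 (.obstruction [1, 2, 10, 5, 12, 6, 8, 0, 7, 11, 3]) (.split 1030 (.obstruction [1, 2, 7, 5, 3,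
  11, 0, 4, 10, 6, 12]) (.color 0 10 4 6664))) (.color 4 4 4 1728)) (.color 0 0 0 832)) (.color
  6 6 6 704))) (.split 19 (.split 80 (.color 2 2 2 1472) (.split 88 (.split 259 (.split 73
  (.obstruction [1, 2, 7, 5, 10, 4, 9, 0, 6, 11, 3]) (.split 1030 (.obstruction [2, 7, 11, 10, 9, 3,
  8, 0, 5, 4, 1]) (.color 4 4 4 704))) (.split 515 (.split 273 (.obstruction [1, 2, 9, 4, 11, 5,
  7, 0, 6, 10, 3]) (.color 3 3 3 3584)) (.color 2 2 2 704))) (.color 0 0 0 6160))) (.color 3 3 3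
  12296))) (.split 22 (.split 1 (.color 1 1 1 2944) (.split 84 (.split 259 (.split 73 (.split
  274 (.obstruction [2, 3, 8, 9, 4, 5, 6, 1, 10, 7, 0]) (.split 521 (.obstruction [1, 2, 4, 7, 8,
  10, 3, 0, 11, 9, 5]) (.color 2 2 2 224))) (.split 137 (.split 69 (.obstruction [1, 2, 3, 10, 9,
  7, 4, 0, 11, 8, 5]) (.color 3 3 3 704)) (.color 1 1 1 4640))) (.color 2 2 2 3200)) (.color 0 0
  0 1608))) (.color 0 0 0 1728)))

/-- The tree is a certificate, which the kernel evaluates. All indices in its leaves count from the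
most recently added vertex, and the bits of the last number of a `color` leaf follow the order of
the surviving types. -/
theorem typeTree_check : typeTree.check startRows startTypes = true := by decide +kernel

theorem groetzsch_adj_iff (u v : Option (Fin 5 ⊕ Fin 5)) :
    groetzsch.Adj u v ↔
      (groetzschRows.getD (groetzschIndex u) 0).testBit (groetzschIndex v) = true := by
  rcases u with _ | u | u <;> rcases v with _ | v | v <;>
    (try fin_cases u) <;> (try fin_cases v) <;>
    simp only [groetzsch, mycielskian, cycleGraph_adj', groetzschIndex] <;> decide

/-- This makes an adjacency-preserving and -reflecting map from the Grötzsch graph injective. -/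
theorem groetzsch_twinFree (u v : Option (Fin 5 ⊕ Fin 5))
    (h : ∀ w, groetzsch.Adj u w ↔ groetzsch.Adj v w) : u = v := by
  simp only [groetzsch_adj_iff] at h
  revert u v
  decide

theorem mem_colorTypes {a b c k t : ℕ} {ts : List ℕ} (h : t ∈ ts) :
    ∃ j, (t, j) ∈ colorTypes a b c ts k := by
  induction ts generalizing k with
  | nil => simp at h
  | cons s ts ih =>
    rcases List.mem_cons.1 h with rfl | h
    · exact ⟨_, List.mem_cons_self ..⟩
    · obtain ⟨j, hj⟩ := ih h (k := k / 2)
      exact ⟨j, List.mem_cons_of_mem _ hj⟩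

theorem of_mem_colorTypes {a b c k t j : ℕ} {ts : List ℕ} (h : (t, j) ∈ colorTypes a b c ts k) :
    (j = 2 ↔ inMajorityType a b c t = true) ∧ j < 3 := by
  induction ts generalizing k with
  | nil => simp [colorTypes] at h
  | cons s ts ih =>
    rcases List.mem_cons.1 h with h | h
    · obtain ⟨rfl, rfl⟩ := Prod.mk.inj h
      split_ifs with hs
      · simp [hs]
      · exact ⟨⟨fun h => by omega, fun h => absurd h hs⟩, by omega⟩
    · exact ih h

theorem testBit_adjCode_of_getElem? {l : List V} {v w : V} {i : ℕ} (h : l[i]? = some w) :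
    (G.adjCode l v).testBit i = true ↔ G.Adj w v := by
  rw [testBit_adjCode, h]
  simp [G.adj_comm]

/-- At a split, a vertex of type `m` either exists and is added to the list, or `m` is removed from
the possible types. A `color` leaf colors the types so that vertices of equally colored types, in
particular of the same type, are never adjacent; color `2` is the majority set. An `obstruction`
leaf names listed vertices that induce the Grötzsch graph. -/
theorem TypeTree.check_sound (hG : G.IsTriangleP2P4Free) {T : TypeTree} {l : List V}
    {g ts : List ℕ} (hT : T.check g ts = true) (h : G.Typed l g ts) :
    groetzsch.IsIndContained G ∨ ∃ a b c, G.Splits a b c := by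
  induction T generalizing l g ts with
  | color a b c k =>
    right
    simp only [check, Bool.and_eq_true, Nat.blt_eq, h.rows, List.length_map,
      List.all_eq_true] at hT
    obtain ⟨⟨⟨ha, hb⟩, hc⟩, hT⟩ := hT
    rw [← h.rows] at hT
    have hmaj : ∀ v, G.InMajority l[a] l[b] l[c] v ↔
        inMajorityType a b c (G.adjCode l v) = true := by
      intro v
      have h1 := testBit_adjCode_of_getElem? (G := G) (v := v) (List.getElem?_eq_getElem ha)
      have h2 := testBit_adjCode_of_getElem? (G := G) (v := v) (List.getElem?_eq_getElem hb)
      have h3 := testBit_adjCode_of_getElem? (G := G) (v := v) (List.getElem?_eq_getElem hc)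
      simp only [InMajority, inMajorityType, ← h1, ← h2, ← h3, Bool.or_eq_true, Bool.and_eq_true,
        Bool.not_eq_true', Bool.not_eq_true]
    choose col hcol using fun v => mem_colorTypes (a := a) (b := b) (c := c) (k := k) (h.mem v)
    have hne : ∀ v w, G.Adj v w → col v ≠ col w := by
      intro v w hvw hc
      have := hT _ (hcol v) _ (hcol w)
      simp only [hc, bne_self_eq_false, Bool.false_or] at this
      exact h.not_adj hG this hvw
    refine ⟨l[a], l[b], l[c], fun v => col v == 0, fun v w hvw => ?_⟩
    have := hne v w hvw
    have hv := of_mem_colorTypes (hcol v)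
    have hw := of_mem_colorTypes (hcol w)
    rw [← hmaj] at hv hw
    rw [← hv.1, ← hw.1]
    refine ⟨by omega, fun h1 h2 h3 => ?_⟩
    have h3 : col v = 0 ↔ col w = 0 := by simpa using congrArg (· = true) h3
    omega
  | obstruction idx =>
    left
    simp only [check, List.all_eq_true, Bool.and_eq_true, Nat.blt_eq, beq_iff_eq,
      List.mem_range, h.rows, List.length_map] at hT
    have hlt : ∀ i : Fin 11, idx.getD i 0 < l.length := fun i => (hT i i.2).1
    refine isIndContained_of_adj_iff groetzsch_twinFree
      (fun u => l[idx.getD (groetzschIndex u) 0]'(hlt _)) fun u v => ?_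
    have hrow : (l.map (G.adjCode l)).getD (idx.getD (groetzschIndex u) 0) 0 =
        G.adjCode l (l[idx.getD (groetzschIndex u) 0]'(hlt _)) := by
      rw [List.getD_eq_getElem _ _ (by rw [List.length_map]; exact hlt _), List.getElem_map]
    rw [groetzsch_adj_iff, ← (hT _ (groetzschIndex u).2).2 _ (groetzschIndex v).2, hrow,
      testBit_adjCode_of_getElem? (List.getElem?_eq_getElem (hlt (groetzschIndex v))), G.adj_comm]
  | split m p q ihp ihq =>
    simp only [check, Bool.and_eq_true] at hT
    by_cases hm : ∃ w, G.adjCode l w = m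
    · obtain ⟨w, hw⟩ := hm
      exact ihp hT.1 (h.cons hG hw)
    · push Not at hm
      exact ihq hT.2 ⟨h.rows, fun v => List.mem_filter.2 ⟨h.mem v, by simpa using hm v⟩⟩

/-! ### Odd cycles avoiding the neighborhood of a vertex -/

/-- A 5-cycle, a vertex without neighbors on it, and a neighbor of it. -/
theorem IsTriangleP2P4Free.groetzsch_or_splits_of_start (hG : G.IsTriangleP2P4Free)
    {v₀ v₁ v₂ v₃ v₄ x t : V} (h₀ : G.Adj v₀ v₁) (h₁ : G.Adj v₁ v₂) (h₂ : G.Adj v₂ v₃)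
    (h₃ : G.Adj v₃ v₄) (h₄ : G.Adj v₄ v₀) (x₀ : ¬ G.Adj x v₀) (x₁ : ¬ G.Adj x v₁)
    (x₂ : ¬ G.Adj x v₂) (x₃ : ¬ G.Adj x v₃) (x₄ : ¬ G.Adj x v₄) (hx : G.Adj t x)
    (t₁ : G.Adj t v₁) (t₄ : G.Adj t v₄) :
    groetzsch.IsIndContained G ∨ ∃ a b c, G.Splits a b c := by
  have a₀ := hG.tri h₀ h₁
  have a₁ := hG.tri h₁ h₂
  have a₂ := hG.tri h₂ h₃
  have a₃ := hG.tri h₃ h₄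
  have a₄ := hG.tri h₄ h₀
  have t₀ := hG.tri t₁ h₀.symm
  have t₂ := hG.tri t₁ h₁
  have t₃ := hG.tri t₄ h₃.symm
  have s := typed_nil (G := G)
  replace s := s.cons hG (w := v₀) (m := 0) rfl
  replace s := s.cons hG (w := v₁) (m := 1) (by simp [adjCode, h₀.symm])
  replace s := s.cons hG (w := v₂) (m := 1)
    (by simp [adjCode, h₁.symm, G.adj_comm v₂ v₀, a₀])
  replace s := s.cons hG (w := v₃) (m := 1)
    (by simp [adjCode, h₂.symm, G.adj_comm v₃ v₁, a₁, a₃])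
  replace s := s.cons hG (w := v₄) (m := 9)
    (by simp [adjCode, h₃.symm, G.adj_comm v₄ v₂, a₂, h₄, a₄])
  replace s := s.cons hG (w := x) (m := 0) (by simp [adjCode, *])
  replace s := s.cons hG (w := t) (m := 19) (by simp [adjCode, *])
  exact TypeTree.check_sound hG typeTree_check s

/-- The possible types over a 5-cycle and a vertex without neighbors on it. -/
theorem odd_type_over_cycle_five : ∀ t ∈
    ([0, 1, 1, 1, 9, 0].foldl (fun s m => (addVertex s.1 m, growTypes s.1 s.2 m)) ([], [0])).2,
    t % 2 = 1 → t ∈ [11, 19, 21, 37, 41] := by decide +kernel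

/-- The possible types over a 7-cycle and a vertex without neighbors on it. -/
theorem odd_type_over_cycle_seven : ∀ t ∈
    ([0, 1, 1, 1, 1, 1, 33, 0].foldl (fun s m => (addVertex s.1 m, growTypes s.1 s.2 m))
      ([], [0])).2,
    t % 2 = 0 := by decide +kernel

/-- If `t` had at most one neighbor on the cycle, the edge `t x` and four consecutive vertices of
the cycle would form `P₂ ∪ P₄`. So `t` has exactly two neighbors there, which are nonadjacent, and a
rotation of the cycle moves them to positions 1 and 4. -/
theorem IsTriangleP2P4Free.groetzsch_or_splits_of_cycle_five (hG : G.IsTriangleP2P4Free)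
    {v₀ v₁ v₂ v₃ v₄ x t : V} (h₀ : G.Adj v₀ v₁) (h₁ : G.Adj v₁ v₂) (h₂ : G.Adj v₂ v₃)
    (h₃ : G.Adj v₃ v₄) (h₄ : G.Adj v₄ v₀) (x₀ : ¬ G.Adj x v₀) (x₁ : ¬ G.Adj x v₁)
    (x₂ : ¬ G.Adj x v₂) (x₃ : ¬ G.Adj x v₃) (x₄ : ¬ G.Adj x v₄) (hx : G.Adj t x) :
    groetzsch.IsIndContained G ∨ ∃ a b c, G.Splits a b c := by
  have a₀ := hG.tri h₀ h₁
  have a₁ := hG.tri h₁ h₂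
  have a₂ := hG.tri h₂ h₃
  have a₃ := hG.tri h₃ h₄
  have a₄ := hG.tri h₄ h₀
  have s := typed_nil (G := G)
  replace s := s.cons hG (w := v₀) (m := 0) rfl
  replace s := s.cons hG (w := v₁) (m := 1) (by simp [adjCode, h₀.symm])
  replace s := s.cons hG (w := v₂) (m := 1)
    (by simp [adjCode, h₁.symm, G.adj_comm v₂ v₀, a₀])
  replace s := s.cons hG (w := v₃) (m := 1)
    (by simp [adjCode, h₂.symm, G.adj_comm v₃ v₁, a₁, a₃])
  replace s := s.cons hG (w := v₄) (m := 9)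
    (by simp [adjCode, h₃.symm, G.adj_comm v₄ v₂, a₂, h₄, a₄])
  replace s := s.cons hG (w := x) (m := 0) (by simp [adjCode, *])
  have hodd : G.adjCode [x, v₄, v₃, v₂, v₁, v₀] t % 2 = 1 := by
    simp only [adjCode, hx, if_true]; omega
  have hbit : ∀ i w, [x, v₄, v₃, v₂, v₁, v₀][i]? = some w →
      (G.adjCode [x, v₄, v₃, v₂, v₁, v₀] t).testBit i = true → G.Adj t w :=
    fun i w h h' => ((testBit_adjCode_of_getElem? h).1 h').symm
  have b₄ := hbit 1 v₄ rfl
  have b₃ := hbit 2 v₃ rfl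
  have b₂ := hbit 3 v₂ rfl
  have b₁ := hbit 4 v₁ rfl
  have b₀ := hbit 5 v₀ rfl
  -- The five odd types are the five nonadjacent pairs of the cycle, with bit `0` for `x`; bits `1`
  -- to `5` stand for `v₄` down to `v₀`.
  have := odd_type_over_cycle_five _ (s.mem t) hodd
  simp only [List.mem_cons, List.not_mem_nil, or_false] at this
  rcases this with h | h | h | h | h <;> rw [h] at b₀ b₁ b₂ b₃ b₄
  · exact hG.groetzsch_or_splits_of_start h₃ h₄ h₀ h₁ h₂ x₃ x₄ x₀ x₁ x₂ hx
      (b₄ (by decide)) (b₂ (by decide))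
  · exact hG.groetzsch_or_splits_of_start h₀ h₁ h₂ h₃ h₄ x₀ x₁ x₂ x₃ x₄ hx
      (b₁ (by decide)) (b₄ (by decide))
  · exact hG.groetzsch_or_splits_of_start h₂ h₃ h₄ h₀ h₁ x₂ x₃ x₄ x₀ x₁ hx
      (b₃ (by decide)) (b₁ (by decide))
  · exact hG.groetzsch_or_splits_of_start h₄ h₀ h₁ h₂ h₃ x₄ x₀ x₁ x₂ x₃ hx
      (b₀ (by decide)) (b₃ (by decide))
  · exact hG.groetzsch_or_splits_of_start h₁ h₂ h₃ h₄ h₀ x₁ x₂ x₃ x₄ x₀ hx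
      (b₂ (by decide)) (b₀ (by decide))

/-- Every vertex with a neighbor has one on an induced 7-cycle. -/
theorem IsTriangleP2P4Free.false_of_cycle_seven (hG : G.IsTriangleP2P4Free)
    {v : ℕ → V} (hv : ∀ i < 7, ∀ j < i, G.Adj (v i) (v j) ↔ i = j + 1 ∨ (i = 6 ∧ j = 0))
    {x t : V} (hxv : ∀ i < 7, ¬ G.Adj x (v i)) (hx : G.Adj t x) : False := by
  have s := typed_nil (G := G)
  replace s := s.cons hG (w := v 0) (m := 0) rfl
  replace s := s.cons hG (w := v 1) (m := 1) (by simp [adjCode, hv])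
  replace s := s.cons hG (w := v 2) (m := 1) (by simp [adjCode, hv])
  replace s := s.cons hG (w := v 3) (m := 1) (by simp [adjCode, hv])
  replace s := s.cons hG (w := v 4) (m := 1) (by simp [adjCode, hv])
  replace s := s.cons hG (w := v 5) (m := 1) (by simp [adjCode, hv])
  replace s := s.cons hG (w := v 6) (m := 33) (by simp [adjCode, hv])
  replace s := s.cons hG (w := x) (m := 0) (by simp [adjCode, hxv])
  -- Bit `0` records adjacency to `x`. All possible types are even, whereas that of `t` is odd.
  have := odd_type_over_cycle_seven _ (s.mem t)
  simp only [adjCode, hx, if_true] at this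
  omega

theorem IsTriangleP2P4Free.induce (hG : G.IsTriangleP2P4Free) (s : Set V) :
    (G.induce s).IsTriangleP2P4Free :=
  ⟨fun h₁ h₂ => hG.tri (G := G) h₁ h₂,
    fun h₁ h₂ h₃ h₄ h₅ h₆ h₇ h₈ h₉ h₁₀ h₁₁ h₁₂ h₁₃ =>
      hG.p2p4 (G := G) h₁ h₂ h₃ h₄ h₅ h₆ h₇ h₈ h₉ h₁₀ h₁₁ h₁₂ h₁₃⟩

/-- A shortest odd closed walk has no chords. -/
theorem exists_odd_chordless_of_not_colorable (h : ¬ G.Colorable 2) :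
    ∃ (n : ℕ) (v : ℕ → V), Odd n ∧ v n = v 0 ∧ (∀ i < n, G.Adj (v i) (v (i + 1))) ∧
      ∀ i j, i + 2 ≤ j → j < n → (i = 0 → j + 1 ≠ n) → ¬ G.Adj (v i) (v j) := by
  classical
  have hex : ∃ n, Odd n ∧ ∃ (u : V) (w : G.Walk u u), w.length = n := by
    rw [two_colorable_iff_forall_loop_even] at h
    push Not at h
    obtain ⟨u, w, hw⟩ := h
    exact ⟨_, Nat.not_even_iff_odd.1 hw, u, w, rfl⟩
  obtain ⟨hodd, u, w, hw⟩ := Nat.find_spec hex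
  have hmin : ∀ (x : V) (p : G.Walk x x), Odd p.length → Nat.find hex ≤ p.length :=
    fun x p hp => Nat.find_min' hex ⟨hp, x, p, rfl⟩
  generalize Nat.find hex = n at hodd hw hmin
  have hadj : ∀ i < n, G.Adj (w.getVert i) (w.getVert (i + 1)) :=
    fun i hi => w.adj_getVert_succ (hw ▸ hi)
  have hend : w.getVert n = w.getVert 0 := by
    rw [← hw, Walk.getVert_length, Walk.getVert_zero]
  have hseg : ∀ i j, i ≤ j → j ≤ n →
      ∃ p : G.Walk (w.getVert i) (w.getVert j), p.length + i = j := by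
    intro i j hij
    induction j, hij using Nat.le_induction with
    | base => exact fun _ => ⟨.nil, by simp⟩
    | succ k hk ih =>
      intro hkn
      obtain ⟨p, hp⟩ := ih (by omega)
      exact ⟨p.concat (hadj k (by omega)), by rw [Walk.length_concat]; omega⟩
  refine ⟨n, w.getVert, hodd, hend, hadj, fun i j hij hj h0 hc => ?_⟩
  obtain ⟨p, hp⟩ := hseg i j (by omega) hj.le
  -- The chord divides the closed walk into two closed walks whose lengths add up to `n + 2`, so
  -- exactly one is odd. Either is shorter than the whole: `i + 2 ≤ j` handles the outer one, and
  -- the excluded pair `0`, `n - 1` the inner one.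
  rcases Nat.even_or_odd p.length with he | ho
  · have := hmin _ (p.concat hc.symm) (by rw [Walk.length_concat]; exact he.add_one)
    rw [Walk.length_concat] at this
    omega
  · obtain ⟨q, hq⟩ := hseg j n hj.le le_rfl
    obtain ⟨r, hr⟩ := hseg 0 i (by omega) (by omega)
    have hlen : (((q.copy rfl hend).append r).concat hc).length = q.length + r.length + 1 := by
      simp
    have := hmin _ (((q.copy rfl hend).append r).concat hc) (by
      rw [hlen]
      obtain ⟨a, ha⟩ := ho
      obtain ⟨b, hb⟩ := hodd
      exact ⟨b - a, by omega⟩)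
    omega

/-- In a chordless odd cycle of length at least 9, the edge `v 0 v 1` and the path `v 3` to `v 6`
form an induced `P₂ ∪ P₄`. Lengths 1 and 3 are a loop and a triangle. -/
theorem IsTriangleP2P4Free.exists_cycle_of_not_colorable (hG : G.IsTriangleP2P4Free)
    (h : ¬ G.Colorable 2) :
    (∃ v₀ v₁ v₂ v₃ v₄, G.Adj v₀ v₁ ∧ G.Adj v₁ v₂ ∧ G.Adj v₂ v₃ ∧ G.Adj v₃ v₄ ∧ G.Adj v₄ v₀) ∨
    ∃ v : ℕ → V, ∀ i < 7, ∀ j < i, G.Adj (v i) (v j) ↔ i = j + 1 ∨ (i = 6 ∧ j = 0) := by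
  obtain ⟨n, v, hn, hend, hadj, hch⟩ := exists_odd_chordless_of_not_colorable h
  have hcases : n = 1 ∨ n = 3 ∨ n = 5 ∨ n = 7 ∨ 9 ≤ n := by
    obtain ⟨k, rfl⟩ := hn; omega
  rcases hcases with rfl | rfl | rfl | rfl | hn9
  · exact absurd (hend ▸ hadj 0 (by omega)) G.irrefl
  · exact absurd (hend ▸ hadj 2 (by omega)).symm
      (hG.tri (hadj 0 (by omega)) (hadj 1 (by omega)))
  · left
    exact ⟨v 0, v 1, v 2, v 3, v 4, hadj 0 (by omega), hadj 1 (by omega), hadj 2 (by omega),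
      hadj 3 (by omega), hend ▸ hadj 4 (by omega)⟩
  · right
    refine ⟨v, fun i hi j hj => ⟨fun h => ?_, ?_⟩⟩
    · by_contra hne
      exact hch j i (by omega) hi (by omega) h.symm
    · rintro (rfl | ⟨rfl, rfl⟩)
      · exact (hadj j (by omega)).symm
      · exact hend ▸ hadj 6 (by omega)
  · exact (hG.p2p4 (hadj 0 (by omega)) (hadj 3 (by omega)) (hadj 4 (by omega))
      (hadj 5 (by omega)) (hch _ _ (by omega) (by omega) (by omega))
      (hch _ _ (by omega) (by omega) (by omega)) (hch _ _ (by omega) (by omega) (by omega))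
      (hch _ _ (by omega) (by omega) (by omega)) (hch _ _ (by omega) (by omega) (by omega))
      (hch _ _ (by omega) (by omega) (by omega)) (hch _ _ (by omega) (by omega) (by omega))
      (hch _ _ (by omega) (by omega) (by omega))
      (hch _ _ (by omega) (by omega) (by omega))).elim

theorem inMajority_self {a w : V} : G.InMajority a a a w ↔ G.Adj a w := by
  simp only [InMajority]; tauto

/-- The structure theorem: a connected graph without triangles, induced `P₂ ∪ P₄` and induced
Grötzsch graphs is the union of a majority set, which is independent, and a bipartite graph. -/
theorem IsTriangleP2P4Free.groetzsch_or_splits (hG : G.IsTriangleP2P4Free) (hc : G.Connected) :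
    groetzsch.IsIndContained G ∨ ∃ a b c, G.Splits a b c := by
  obtain ⟨x⟩ := hc.nonempty
  -- This set contains `x` itself, as an isolated vertex of the induced graph. A cycle in it has no
  -- neighbor of `x`.
  by_cases hcol : (G.induce {v | ¬ G.Adj x v}).Colorable 2
  · right
    classical
    obtain ⟨f⟩ := hcol
    refine ⟨x, x, x, fun v => if h : ¬ G.Adj x v then f ⟨v, h⟩ == 0 else true,
      fun v w hvw => ?_⟩
    simp only [inMajority_self]
    refine ⟨fun h => hG.tri h.1 hvw h.2, fun hv hw h => ?_⟩
    rw [dif_pos hv, dif_pos hw] at h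
    have := f.valid (v := ⟨v, hv⟩) (w := ⟨w, hw⟩) hvw
    have h3 : f ⟨v, hv⟩ = 0 ↔ f ⟨w, hw⟩ = 0 := by simpa using congrArg (· = true) h
    omega
  -- Without a neighbor of `x` the connected graph is a single vertex, contradicting `hcol`.
  · have ht : ∃ t, G.Adj t x := by
      by_contra hno
      push Not at hno
      refine hcol ⟨Coloring.mk (fun _ => 0) fun {u v} huv => ?_⟩
      have huv : G.Adj u.1 v.1 := huv
      have : Nontrivial V := ⟨_, _, huv.ne⟩
      obtain ⟨t, ht⟩ := hc.preconnected.exists_adj_of_nontrivial x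
      exact absurd ht.symm (hno t)
    obtain ⟨t, ht⟩ := ht
    rcases (hG.induce _).exists_cycle_of_not_colorable hcol with
      ⟨v₀, v₁, v₂, v₃, v₄, h₀, h₁, h₂, h₃, h₄⟩ | ⟨v, hv⟩
    · exact hG.groetzsch_or_splits_of_cycle_five h₀ h₁ h₂ h₃ h₄ v₀.2 v₁.2 v₂.2 v₃.2 v₄.2 ht
    · exact (hG.false_of_cycle_seven (v := fun i => (v i).1) hv (fun i _ => (v i).2) ht).elim

/-! ### Graphs that contain the Grötzsch graph, and the Clebsch graph -/

/-- The adjacency rows of the Grötzsch graph, the vertices of which are added in the order cycle,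
apex, shadows, together with the possible types over it. -/
def groetzschTypes : List ℕ × List ℕ :=
  [0, 1, 1, 1, 9, 0, 19, 82, 84, 88, 592].foldl
    (fun s m => (addVertex s.1 m, growTypes s.1 s.2 m)) ([], [0])

/-- The vertices of the Clebsch graph that correspond to the types over the Grötzsch graph. -/
def clebschIndex (t : ℕ) : ℕ :=
  ((([31, 76, 152, 273, 325, 352, 515, 585, 608, 650, 672, 1030, 1170, 1184, 1300, 1312].zip
    [1, 13, 6, 15, 4, 3, 2, 8, 14, 11, 5, 7, 12, 0, 10, 9]).lookup t).getD 0)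

/-- Adjacency in the Clebsch graph. -/
def clebschAdj (i j : ℕ) : Bool := [1, 2, 4, 8, 15].contains (i ^^^ j)

/-- Type `0` admits no neighbors at all, hence does not occur in a connected graph with an edge.
Between nonzero types adjacency is forced one way or the other, exactly as between the assigned
vertices of the Clebsch graph. -/
theorem groetzschTypes_check : ∀ s ∈ groetzschTypes.2, clebschIndex s < 16 ∧
    neverAdj groetzschTypes.1 0 s = true ∧ ∀ t ∈ groetzschTypes.2, s = 0 ∨ t = 0 ∨
      (if clebschAdj (clebschIndex s) (clebschIndex t) then alwaysAdj groetzschTypes.1 s t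
        else neverAdj groetzschTypes.1 s t) = true := by
  decide +kernel

/-- The vertex of the Clebsch graph with the bits of a number. -/
def clebschVertex (i : ℕ) : Fin 4 → Bool := fun k => i.testBit k

theorem clebsch_adj_clebschVertex : ∀ i < 16, ∀ j < 16,
    clebsch.Adj (clebschVertex i) (clebschVertex j) ↔ clebschAdj i j = true := by
  unfold clebsch
  decide +kernel

theorem typed_groetzsch (hG : G.IsTriangleP2P4Free) (e : groetzsch ↪g G) :
    ∃ l, G.Typed l groetzschTypes.1 groetzschTypes.2 := by
  have key : ∀ (L : List (Option (Fin 5 ⊕ Fin 5))) v,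
      G.adjCode (L.map e) (e v) = L.foldr (fun w n => 2 * n +
        if (groetzschRows.getD (groetzschIndex v) 0).testBit (groetzschIndex w) then 1 else 0)
        0 := by
    intro L v
    induction L with
    | nil => rfl
    | cons w L ih => simp only [List.map_cons, adjCode, ih, e.map_adj_iff, groetzsch_adj_iff,
        List.foldr_cons]
  have s := typed_nil (G := G)
  replace s := s.cons hG (key [] (some (.inl 0)))
  replace s := s.cons hG (key [some (.inl 0)] (some (.inl 1)))
  replace s := s.cons hG (key [some (.inl 1), some (.inl 0)] (some (.inl 2)))
  replace s := s.cons hG (key [some (.inl 2), some (.inl 1), some (.inl 0)] (some (.inl 3)))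
  replace s := s.cons hG (key [some (.inl 3), some (.inl 2), some (.inl 1), some (.inl 0)]
    (some (.inl 4)))
  replace s := s.cons hG (key [some (.inl 4), some (.inl 3), some (.inl 2), some (.inl 1),
    some (.inl 0)] none)
  replace s := s.cons hG (key [none, some (.inl 4), some (.inl 3), some (.inl 2), some (.inl 1),
    some (.inl 0)] (some (.inr 0)))
  replace s := s.cons hG (key [some (.inr 0), none, some (.inl 4), some (.inl 3), some (.inl 2),
    some (.inl 1), some (.inl 0)] (some (.inr 1)))
  replace s := s.cons hG (key [some (.inr 1), some (.inr 0), none, some (.inl 4), some (.inl 3),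
    some (.inl 2), some (.inl 1), some (.inl 0)] (some (.inr 2)))
  replace s := s.cons hG (key [some (.inr 2), some (.inr 1), some (.inr 0), none, some (.inl 4),
    some (.inl 3), some (.inl 2), some (.inl 1), some (.inl 0)] (some (.inr 3)))
  replace s := s.cons hG (key [some (.inr 3), some (.inr 2), some (.inr 1), some (.inr 0), none,
    some (.inl 4), some (.inl 3), some (.inl 2), some (.inl 1), some (.inl 0)] (some (.inr 4)))
  -- The codes produced by `key` evaluate to the numbers listed in `groetzschTypes`.
  exact ⟨_, s⟩

/-- The map `φ` preserves and reflects adjacency, so two vertices with the same image are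
nonadjacent with equal neighborhoods. That is a comparable pair; excluding it makes `φ` injective.
-/
theorem IsTriangleP2P4Free.isIndContained_clebsch (hG : G.IsTriangleP2P4Free)
    (hc : G.Connected) (h : groetzsch.IsIndContained G) (hcomp : ¬ G.HasComparablePair) :
    G.IsIndContained clebsch := by
  obtain ⟨e⟩ := h
  obtain ⟨l, s⟩ := typed_groetzsch hG e
  have hnt : Nontrivial V := e.injective.nontrivial
  have hne : ∀ v, G.adjCode l v ≠ 0 := by
    intro v hv
    obtain ⟨w, hw⟩ := hc.preconnected.exists_adj_of_nontrivial v
    refine s.not_adj hG ?_ hw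
    rw [hv]
    exact (groetzschTypes_check _ (s.mem w)).2.1
  set φ : V → (Fin 4 → Bool) := fun v => clebschVertex (clebschIndex (G.adjCode l v)) with hφ
  have hadj : ∀ v w, clebsch.Adj (φ v) (φ w) ↔ G.Adj v w := by
    intro v w
    have h1 := groetzschTypes_check _ (s.mem v)
    have h2 := groetzschTypes_check _ (s.mem w)
    rw [hφ, clebsch_adj_clebschVertex _ h1.1 _ h2.1]
    have h3 := ((h1.2.2 _ (s.mem w)).resolve_left (hne v)).resolve_left (hne w)
    split_ifs at h3 with h4
    · exact ⟨fun _ => s.adj hG h3, fun _ => h4⟩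
    · exact ⟨fun h => absurd h h4, fun h => absurd h (s.not_adj hG h3)⟩
  refine ⟨⟨⟨φ, fun v w hvw => ?_⟩, hadj _ _⟩⟩
  by_contra hvw'
  refine hcomp ⟨v, w, hvw', ?_, fun z hz => ?_⟩
  · rw [← hadj, hvw]; exact clebsch.irrefl
  · rw [mem_neighborSet, ← hadj] at hz ⊢
    rwa [← hvw]

/-- The color is the parity of the first three coordinates plus twice the fourth. Changing one of
the first three coordinates changes the parity; the other edges change the fourth coordinate. -/
theorem clebsch_colorable : clebsch.Colorable 4 := by
  refine ⟨Coloring.mk (fun x => [0, 1, 1, 0, 1, 0, 0, 1, 2, 3, 3, 2, 3, 2, 2, 3].getD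
    ((x 0).toNat + 2 * (x 1).toNat + 4 * (x 2).toNat + 8 * (x 3).toNat) 0) ?_⟩
  unfold clebsch
  decide +kernel

/-- Given a 3-coloring, recolor each cycle vertex that has the color of the apex with the color of
its shadow. The coloring stays proper on the 5-cycle, because a shadow has the same neighbors there,
but it avoids the apex color, leaving two colors for an odd cycle. -/
theorem not_colorable_groetzsch : ¬ groetzsch.Colorable 3 := by
  rintro ⟨C⟩
  have aux : ∀ (k : Fin 3) (c : Fin 5 → Fin 3), (∀ i, c i ≠ k) →
      ∃ i j, (cycleGraph 5).Adj i j ∧ c i = c j := by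
    intro k c hk
    by_contra! hne
    have h₀ := hne 0 1 (by decide)
    have h₁ := hne 1 2 (by decide)
    have h₂ := hne 2 3 (by decide)
    have h₃ := hne 3 4 (by decide)
    have h₄ := hne 4 0 (by decide)
    have k₀ := hk 0
    have k₁ := hk 1
    have k₂ := hk 2
    have k₃ := hk 3
    have k₄ := hk 4
    omega
  obtain ⟨i, j, hij, h⟩ := aux (C none)
    (fun i => if C (some (.inl i)) = C none then C (some (.inr i)) else C (some (.inl i)))
    (fun i => by
      split_ifs with h
      · exact C.valid (v := some (.inr i)) (w := none) trivial
      · exact h)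
  split_ifs at h with h1 h2 h2
  · exact C.valid (v := some (.inl i)) (w := some (.inl j)) hij (h1.trans h2.symm)
  · exact C.valid (v := some (.inr i)) (w := some (.inl j)) hij h
  · exact C.valid (v := some (.inl i)) (w := some (.inr j)) hij h
  · exact C.valid (v := some (.inl i)) (w := some (.inl j)) hij h

/-- A graph between the Grötzsch and the Clebsch graph has chromatic number 4. -/
theorem chromaticNumber_eq_four (h₁ : groetzsch.IsIndContained G)
    (h₂ : G.IsIndContained clebsch) : G.chromaticNumber = 4 := by
  obtain ⟨e⟩ := h₁
  obtain ⟨f⟩ := h₂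
  refine le_antisymm (clebsch_colorable.of_hom f.toHom).chromaticNumber_le ?_
  by_contra hlt
  have h3 : G.chromaticNumber ≤ (3 : ℕ) := Order.le_of_lt_add_one (by
    rw [not_le] at hlt
    exact hlt.trans_eq (by norm_num))
  exact not_colorable_groetzsch ((chromaticNumber_le_iff_colorable.1 h3).of_hom e.toHom)

/-! ### Paw-free graphs with a triangle -/

theorem not_adj_of_not_paw (h : ¬ paw.IsIndContained G) {a b c d : V} (hab : G.Adj a b)
    (hbc : G.Adj b c) (hac : G.Adj a c) (hda : G.Adj d a) (hdb : ¬ G.Adj d b) : G.Adj d c := by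
  by_contra hdc
  refine h (isIndContained_of_adj_iff ?_ ![a, b, c, d] ?_)
  · simp only [paw, fromEdgeSet_adj]; decide
  · have hdb' : ¬ G.Adj b d := fun h => hdb h.symm
    have hdc' : ¬ G.Adj c d := fun h => hdc h.symm
    intro u v
    fin_cases u <;> fin_cases v <;>
      simp [paw, hab, hbc, hac, hda, hdb, hdc, hab.symm, hbc.symm, hac.symm, hda.symm, hdb', hdc']

/-- In a connected paw-free graph every vertex has a neighbor in every triangle. -/
theorem exists_adj_triangle (hc : G.Connected) (h : ¬ paw.IsIndContained G) {a b c : V}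
    (hab : G.Adj a b) (hbc : G.Adj b c) (hac : G.Adj a c) (v : V) :
    G.Adj v a ∨ G.Adj v b ∨ G.Adj v c := by
  obtain ⟨w⟩ := hc.preconnected v a
  induction w with
  | nil => exact Or.inr (Or.inl hab)
  | @cons v y z hvy _ ih =>
    -- The neighbor `y` of `v` is adjacent to a vertex of the triangle, hence to two of them. If `v`
    -- missed the triangle, then `y` with these two and the pendant edge to `v` would be a paw.
    have hy := ih hab hac
    by_contra! hno
    obtain ⟨h1, h2, h3⟩ := hno
    rcases hy with hy | hy | hy
    · by_cases hyb : G.Adj y b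
      · exact h1 (not_adj_of_not_paw h hyb hab.symm hy hvy h2)
      · exact h3 (not_adj_of_not_paw h hy hac (not_adj_of_not_paw h hab hbc hac hy hyb) hvy h1)
    · by_cases hya : G.Adj y z
      · exact h2 (not_adj_of_not_paw h hya hab hy hvy h1)
      · exact h3 (not_adj_of_not_paw h hy hbc
          (not_adj_of_not_paw h hab.symm hac hbc hy hya) hvy h2)
    · by_cases hya : G.Adj y z
      · exact h3 (not_adj_of_not_paw h hya hac hy hvy h1)
      · exact h2 (not_adj_of_not_paw h hy hbc.symm
          (not_adj_of_not_paw h hac.symm hab hbc.symm hy hya) hvy h3)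

/-- In a connected paw-free graph with a triangle, every vertex is in a triangle. -/
theorem exists_triangle (hc : G.Connected) (h : ¬ paw.IsIndContained G) {a b c : V}
    (hab : G.Adj a b) (hbc : G.Adj b c) (hac : G.Adj a c) (v : V) :
    ∃ x y, G.Adj v x ∧ G.Adj x y ∧ G.Adj v y := by
  rcases exists_adj_triangle hc h hab hbc hac v with hv | hv | hv
  · by_cases hvb : G.Adj v b
    · exact ⟨a, b, hv, hab, hvb⟩
    · exact ⟨a, c, hv, hac, not_adj_of_not_paw h hab hbc hac hv hvb⟩
  · by_cases hva : G.Adj v a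
    · exact ⟨a, b, hva, hab, hv⟩
    · exact ⟨b, c, hv, hbc, not_adj_of_not_paw h hab.symm hac hbc hv hva⟩
  · by_cases hva : G.Adj v a
    · exact ⟨a, c, hva, hac, hv⟩
    · exact ⟨c, b, hv, hbc.symm, not_adj_of_not_paw h hac.symm hab hbc.symm hv hva⟩

/-- A connected paw-free graph with a triangle is complete multipartite. -/
theorem not_adj_trans (hc : G.Connected) (h : ¬ paw.IsIndContained G) {a b c : V}
    (hab : G.Adj a b) (hbc : G.Adj b c) (hac : G.Adj a c) {u v w : V} (huv : ¬ G.Adj u v)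
    (hvw : ¬ G.Adj v w) : ¬ G.Adj u w := by
  intro huw
  obtain ⟨x, y, hux, hxy, huy⟩ := exists_triangle hc h hab hbc hac u
  -- The edge `u w` lies in a triangle `u w z`. As `v` has a neighbor in it, but neither `u` nor
  -- `w`, a paw arises.
  obtain ⟨z, hwz, huz⟩ : ∃ z, G.Adj w z ∧ G.Adj u z := by
    by_cases hwx : G.Adj w x
    · exact ⟨x, hwx, hux⟩
    · exact ⟨y, not_adj_of_not_paw h hux hxy huy huw.symm hwx, huy⟩
  rcases exists_adj_triangle hc h huw hwz huz v with hv | hv | hv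
  · exact huv hv.symm
  · exact hvw hv
  · exact hvw (not_adj_of_not_paw h huz.symm huw hwz.symm hv fun h => huv h.symm)

/-- When nonadjacency is transitive, nonadjacent vertices have the same neighborhood. -/
theorem hasComparablePair_or_eq_top (htr : ∀ {u v w}, ¬ G.Adj u v → ¬ G.Adj v w → ¬ G.Adj u w) :
    G.HasComparablePair ∨ G = ⊤ := by
  by_cases h : ∃ u v, u ≠ v ∧ ¬ G.Adj u v
  · obtain ⟨u, v, hne, huv⟩ := h
    left
    refine ⟨u, v, hne, huv, fun w hw => ?_⟩
    by_contra hvw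
    exact htr huv hvw hw
  · right
    push Not at h
    ext u v
    exact ⟨fun h => h.ne, h u v⟩

/-- A vertex adjacent to all of `a`, `b`, `c` would create `K₄`, so there are only three classes.
The majority set is the class of `c`, and adjacency to `a` separates the other two. -/
theorem splits_of_colorable (htr : ∀ {u v w}, ¬ G.Adj u v → ¬ G.Adj v w → ¬ G.Adj u w)
    {a b c : V} (hab : G.Adj a b) (hbc : G.Adj b c) (hac : G.Adj a c) (hcol : G.Colorable 3) :
    G.Splits a b c := by
  classical
  have hclass : ∀ v, ¬ G.Adj a v ∨ ¬ G.Adj b v ∨ ¬ G.Adj c v := by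
    intro v
    by_contra! hv
    obtain ⟨C⟩ := hcol
    have h1 := C.valid hab
    have h2 := C.valid hbc
    have h3 := C.valid hac
    have h4 := C.valid hv.1
    have h5 := C.valid hv.2.1
    have h6 := C.valid hv.2.2
    omega
  have hadj : ∀ {x v w}, G.Adj v w → ¬ G.Adj x v → G.Adj x w := by
    intro x v w hvw hxv
    by_contra hxw
    exact htr (fun h => hxv h.symm) hxw hvw
  refine ⟨fun v => decide (G.Adj a v), fun v w hvw => ⟨?_, fun hv hw => ?_⟩⟩
  · have h1 := hclass v
    have h2 := hclass w
    have h3 := fun x => hadj (x := x) hvw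
    have h4 := fun x => hadj (x := x) hvw.symm
    have h5 := h3 a
    have h6 := h3 b
    have h7 := h3 c
    simp only [InMajority]
    tauto
  · rw [ne_eq, decide_eq_decide]
    have h1 := hclass v
    have h2 := hclass w
    have h3 := fun x => hadj (x := x) hvw
    have h5 := h3 a
    have h6 := h3 b
    have h7 := h3 c
    have h8 := fun h1 h2 => htr (u := a) (v := v) (w := b) h1 h2 hab
    have h9 := fun h1 h2 => htr (u := a) (v := w) (w := b) h1 h2 hab
    simp only [InMajority] at hv hw
    simp only [G.adj_comm v b, G.adj_comm w b] at h8 h9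
    tauto

end SimpleGraph

/-! ### Programs with counted loops and their running time -/

namespace RAM

/-- Programs in which a loop runs a register from `0` to `n - 1`, where `n` is in register `0`. -/
inductive Cmd where
  | skip
  | put (k : ℕ) (i e : Exp)
  | seq (p q : Cmd)
  | ite (e : Exp) (p q : Cmd)
  | loop (x : ℕ) (p : Cmd)

/-- The compilation of a command. -/
def Cmd.toProgram : Cmd → Program
  | .skip => .skip
  | .put k i e => .put k i e
  | .seq p q => .seq p.toProgram q.toProgram
  | .ite e p q => .ite e p.toProgram q.toProgram
  | .loop x p => .seq (.set x (.const 0)) (.loop (.sub (.reg 0) (.reg x))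
      (.seq p.toProgram (.set x (.add (.reg x) (.const 1)))))

/-- Assigns a value to a register. -/
def Store.setReg (s : Store) (x v : ℕ) : Store := ⟨Function.update s.reg x v, s.arr⟩

/-- Assigns a value to an array cell. -/
def Store.putArr (s : Store) (k i v : ℕ) : Store :=
  ⟨s.reg, Function.update s.arr k (Function.update (s.arr k) i v)⟩

theorem Store.setReg_reg_self {s : Store} {x v : ℕ} : (s.setReg x v).reg x = v :=
  Function.update_self ..

theorem Store.setReg_reg_of_ne {s : Store} {x v y : ℕ} (h : y ≠ x) :
    (s.setReg x v).reg y = s.reg y :=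
  Function.update_of_ne h ..

theorem Store.putArr_arr_self {s : Store} {k i v : ℕ} :
    (s.putArr k i v).arr k = Function.update (s.arr k) i v :=
  Function.update_self ..

theorem Store.putArr_arr_of_ne {s : Store} {k i v j : ℕ} (h : j ≠ k) :
    (s.putArr k i v).arr j = s.arr j :=
  Function.update_of_ne h ..

/-- The memory after running a command. -/
def Cmd.run : Cmd → Store → Store
  | .skip, s => s
  | .put k i e, s => s.putArr k (i.eval s) (e.eval s)
  | .seq p q, s => q.run (p.run s)
  | .ite e p q, s => if e.eval s ≠ 0 then p.run s else q.run s
  | .loop x p, s => (fun s => (p.run s).setReg x (s.reg x + 1))^[s.reg 0] (s.setReg x 0)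

/-- The registers that a command changes. -/
def Cmd.vars : Cmd → List ℕ
  | .skip => []
  | .put _ _ _ => []
  | .seq p q => p.vars ++ q.vars
  | .ite _ p q => p.vars ++ q.vars
  | .loop x p => x :: p.vars

/-- The arrays that a command changes. -/
def Cmd.arrs : Cmd → List ℕ
  | .skip => []
  | .put k _ _ => [k]
  | .seq p q => p.arrs ++ q.arrs
  | .ite _ p q => p.arrs ++ q.arrs
  | .loop _ p => p.arrs

/-- Loops do not change their own counters, nor the number `n`. -/
def Cmd.WellFormed : Cmd → Prop
  | .skip => True
  | .put _ _ _ => True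
  | .seq p q => p.WellFormed ∧ q.WellFormed
  | .ite _ p q => p.WellFormed ∧ q.WellFormed
  | .loop x p => x ≠ 0 ∧ x ∉ p.vars ∧ p.WellFormed

/-- A bound for the running time. -/
noncomputable def Cmd.timeBound : Cmd → Polynomial ℕ
  | .skip => 1
  | .put _ i e => Polynomial.C (i.cost + e.cost + 1)
  | .seq p q => p.timeBound + q.timeBound
  | .ite e p q => Polynomial.C (e.cost + 1) + p.timeBound + q.timeBound
  | .loop _ p => Polynomial.X * (p.timeBound + 8) + 6

theorem Cmd.run_reg {p : Cmd} {s : Store} {y : ℕ} (hy : y ∉ p.vars) :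
    (p.run s).reg y = s.reg y := by
  induction p generalizing s with
  | skip => rfl
  | put => rfl
  | seq p q ihp ihq =>
    simp only [vars, List.mem_append, not_or] at hy
    rw [run, ihq hy.2, ihp hy.1]
  | ite e p q ihp ihq =>
    simp only [vars, List.mem_append, not_or] at hy
    rw [run]
    split_ifs
    exacts [ihp hy.1, ihq hy.2]
  | loop x p ih =>
    simp only [vars, List.mem_cons, not_or] at hy
    rw [run]
    have key : ∀ k (s : Store),
        ((fun s => (p.run s).setReg x (s.reg x + 1))^[k] s).reg y = s.reg y := by
      intro k
      induction k with
      | zero => exact fun _ => rfl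
      | succ k ihk =>
        intro s
        rw [Function.iterate_succ_apply, ihk, Store.setReg_reg_of_ne hy.1, ih hy.2]
    rw [key, Store.setReg_reg_of_ne hy.1]

theorem Cmd.run_arr {p : Cmd} {s : Store} {k : ℕ} (hk : k ∉ p.arrs) :
    (p.run s).arr k = s.arr k := by
  induction p generalizing s with
  | skip => rfl
  | put k' i e =>
    rw [arrs, List.mem_singleton] at hk
    rw [run, Store.putArr_arr_of_ne hk]
  | seq p q ihp ihq =>
    simp only [arrs, List.mem_append, not_or] at hk
    rw [run, ihq hk.2, ihp hk.1]
  | ite e p q ihp ihq =>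
    simp only [arrs, List.mem_append, not_or] at hk
    rw [run]
    split_ifs
    exacts [ihp hk.1, ihq hk.2]
  | loop x p ih =>
    rw [run]
    have key : ∀ j (s : Store),
        ((fun s => (p.run s).setReg x (s.reg x + 1))^[j] s).arr k = s.arr k := by
      intro j
      induction j with
      | zero => exact fun _ => rfl
      | succ j ihj =>
        intro s
        rw [Function.iterate_succ_apply, ihj, Store.setReg, ih hk]
    rw [key, Store.setReg]

theorem Cmd.zero_notMem_vars {p : Cmd} (hp : p.WellFormed) : 0 ∉ p.vars := by
  induction p with
  | skip => simp [vars]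
  | put => simp [vars]
  | seq p q ihp ihq => simp [vars, ihp hp.1, ihq hp.2]
  | ite e p q ihp ihq => simp [vars, ihp hp.1, ihq hp.2]
  | loop x p ih => simp [vars, ih hp.2.2, hp.1.symm]

theorem exec_loop_of_eval_eq_zero {e : Exp} {p : Program} {s : Store} (h : e.eval s = 0) :
    Exec (.loop e p) s (e.cost + 1) s := by
  constructor
  exact h

/-- No well-formed command changes register `0`, and no loop body changes its counter, so every loop
runs exactly `n` times and nesting multiplies polynomials in `n`. -/
theorem Cmd.exec {p : Cmd} (hp : p.WellFormed) (s : Store) :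
    ∃ t, Exec p.toProgram s t (p.run s) ∧ t ≤ p.timeBound.eval (s.reg 0) := by
  induction p generalizing s with
  | skip => exact ⟨1, .skip s, by simp [timeBound]⟩
  | put k i e => exact ⟨_, .put k i e s, by simp [timeBound]⟩
  | seq p q ihp ihq =>
    obtain ⟨t₁, h₁, b₁⟩ := ihp hp.1 s
    obtain ⟨t₂, h₂, b₂⟩ := ihq hp.2 (p.run s)
    rw [run_reg (zero_notMem_vars hp.1)] at b₂
    exact ⟨_, .seq h₁ h₂, by rw [timeBound, Polynomial.eval_add]; omega⟩
  | ite e p q ihp ihq =>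
    obtain ⟨t₁, h₁, b₁⟩ := ihp hp.1 s
    obtain ⟨t₂, h₂, b₂⟩ := ihq hp.2 s
    simp only [toProgram, run, timeBound, Polynomial.eval_add, Polynomial.eval_C]
    split_ifs with he
    · exact ⟨_, .ite_true he h₁, by omega⟩
    · exact ⟨_, .ite_false (not_not.1 he) h₂, by omega⟩
  | loop x p ih =>
    obtain ⟨hx, hxp, hp⟩ := hp
    -- Each round costs 4 steps for the test and 4 for the increment besides the body, and the final
    -- test costs 4. Setting the counter adds 2, whence the constants 8 and 6 of `timeBound`.
    have key : ∀ k (s' : Store), s'.reg 0 = s.reg 0 → s'.reg x + k = s.reg 0 →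
        ∃ t, Exec (.loop (.sub (.reg 0) (.reg x))
          (.seq p.toProgram (.set x (.add (.reg x) (.const 1))))) s' t
          ((fun s => (p.run s).setReg x (s.reg x + 1))^[k] s') ∧
          t ≤ k * (p.timeBound.eval (s.reg 0) + 8) + 4 := by
      intro k
      induction k with
      | zero =>
        intro s' h0 hk
        exact ⟨_, exec_loop_of_eval_eq_zero (by simp only [Exp.eval]; omega), by simp [Exp.cost]⟩
      | succ k ihk =>
        intro s' h0 hk
        obtain ⟨t₁, h₁, b₁⟩ := ih hp s'
        rw [h0] at b₁
        have hxs : (p.run s').reg x = s'.reg x := run_reg hxp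
        obtain ⟨t₂, h₂, b₂⟩ := ihk ((p.run s').setReg x (s'.reg x + 1))
          (by rw [Store.setReg_reg_of_ne hx.symm, run_reg (zero_notMem_vars hp), h0])
          (by rw [Store.setReg_reg_self]; omega)
        refine ⟨_, .loop_step (t₂ := t₂) (by simp only [Exp.eval]; omega)
          (.seq h₁ (.set x (.add (.reg x) (.const 1)) _)) ?_, ?_⟩
        · simp only [Exp.eval, hxs]
          exact h₂
        · simp only [Exp.cost, add_mul, one_mul]
          omega
    obtain ⟨t, ht, hb⟩ := key (s.reg 0) (s.setReg x 0)
      (by rw [Store.setReg_reg_of_ne hx.symm])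
      (by rw [Store.setReg_reg_self, zero_add])
    refine ⟨_, .seq (.set x (.const 0) s) ht, ?_⟩
    simp only [timeBound, Polynomial.eval_add, Polynomial.eval_mul, Polynomial.eval_X,
      Polynomial.eval_ofNat, Exp.cost]
    omega

/-- The invariant rule for loops. -/
theorem Cmd.run_loop_induction {x : ℕ} {p : Cmd} (hp : (Cmd.loop x p).WellFormed) {s : Store}
    (I : ℕ → (ℕ → ℕ → ℕ) → Prop) (h0 : I 0 s.arr)
    (step : ∀ i s', i < s.reg 0 → s'.reg x = i →
      (∀ y, y ≠ x → y ∉ p.vars → s'.reg y = s.reg y) → (∀ k ∉ p.arrs, s'.arr k = s.arr k) →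
      I i s'.arr → I (i + 1) (p.run s').arr) :
    I (s.reg 0) ((Cmd.loop x p).run s).arr := by
  obtain ⟨hx, hxp, -⟩ := hp
  have key : ∀ i ≤ s.reg 0, ∀ s',
      s' = (fun s => (p.run s).setReg x (s.reg x + 1))^[i] (s.setReg x 0) →
      s'.reg x = i ∧ (∀ y, y ≠ x → y ∉ p.vars → s'.reg y = s.reg y) ∧
      (∀ k ∉ p.arrs, s'.arr k = s.arr k) ∧ I i s'.arr := by
    intro i
    induction i with
    | zero =>
      rintro - _ rfl
      exact ⟨Store.setReg_reg_self, fun y hy _ => Store.setReg_reg_of_ne hy, fun _ _ => rfl, h0⟩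
    | succ i ih =>
      rintro hi _ rfl
      obtain ⟨h1, h2, h3, h4⟩ := ih (by omega) _ rfl
      rw [Function.iterate_succ_apply']
      generalize (fun s => (p.run s).setReg x (s.reg x + 1))^[i] (s.setReg x 0) = s' at *
      refine ⟨by rw [Store.setReg_reg_self, h1], fun y hy hyp => ?_,
        fun k hk => ?_, step i s' hi h1 h2 h3 h4⟩
      · rw [Store.setReg_reg_of_ne hy, run_reg hyp, h2 y hy hyp]
      · rw [Store.setReg, run_arr hk, h3 k hk]
  exact (key _ le_rfl _ rfl).2.2.2

/-! ### The coloring algorithm and its correctness -/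

open Classical in
/-- Register `0` holds `n`, array `0` an adjacency matrix, and array `3` the starts of its rows. -/
structure Ready (n : ℕ) (E : ℕ → ℕ → Prop) (s : Store) : Prop where
  reg_zero : s.reg 0 = n
  adj : ∀ i < n, ∀ j < n, s.arr 0 (s.arr 3 i + j) = if E i j then 1 else 0

variable {n : ℕ} {E : ℕ → ℕ → Prop} {s s' : Store}

theorem Ready.frame (h : Ready n E s) (h₀ : s'.reg 0 = s.reg 0) (h₁ : s'.arr 0 = s.arr 0)
    (h₃ : s'.arr 3 = s.arr 3) : Ready n E s' :=
  ⟨h₀.trans h.reg_zero, by rw [h₁, h₃]; exact h.adj⟩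

/-- The adjacency of two vertices given by registers. -/
def adjExp (x y : ℕ) : Exp := .cell 0 (.add (.cell 3 (.reg x)) (.reg y))

open Classical in
theorem Ready.eval_adjExp (h : Ready n E s) {x y : ℕ} (hx : s.reg x < n) (hy : s.reg y < n) :
    (adjExp x y).eval s = if E (s.reg x) (s.reg y) then 1 else 0 :=
  h.adj _ hx _ hy

/-- `w` has more neighbors among `a`, `b` than among `c`. -/
def Majority (E : ℕ → ℕ → Prop) (a b c w : ℕ) : Prop :=
  (E a w ∧ E b w) ∨ ((E a w ∨ E b w) ∧ ¬ E c w)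

/-- Writes the majority set of the registers `1`, `2`, `3` with color `2` into array `2`, and
color `3` for the other vertices. -/
def initCmd : Cmd :=
  .loop 5 (.ite (.sub (.add (adjExp 1 5) (adjExp 2 5)) (adjExp 3 5))
    (.put 2 (.reg 5) (.const 2)) (.put 2 (.reg 5) (.const 3)))

open Classical in
theorem initCmd_run (h : Ready n E s) (h₁ : s.reg 1 < n) (h₂ : s.reg 2 < n) (h₃ : s.reg 3 < n) :
    ∀ i < n, (initCmd.run s).arr 2 i =
      if Majority E (s.reg 1) (s.reg 2) (s.reg 3) i then 2 else 3 := by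
  rw [← h.reg_zero]
  refine Cmd.run_loop_induction (by simp [Cmd.WellFormed, Cmd.vars])
    (fun i M => ∀ j < i, M 2 j = if Majority E (s.reg 1) (s.reg 2) (s.reg 3) j then 2 else 3)
    (fun j hj => by omega) fun i s' hi hx hr ha ih j hj => ?_
  rw [h.reg_zero] at hi
  simp only [Cmd.vars, List.append_nil, List.not_mem_nil, not_false_eq_true, forall_const] at hr
  simp only [Cmd.arrs, List.mem_append, List.mem_singleton, or_self] at ha
  have h' : Ready n E s' := h.frame (hr 0 (by omega)) (ha 0 (by omega)) (ha 3 (by omega))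
  have e₁ := hr 1 (by omega)
  have e₂ := hr 2 (by omega)
  have e₃ := hr 3 (by omega)
  -- The truncated difference is positive exactly if the neighbors among `a`, `b` outnumber those
  -- among `c`.
  have key : (Exp.sub (.add (adjExp 1 5) (adjExp 2 5)) (adjExp 3 5)).eval s' ≠ 0 ↔
      Majority E (s.reg 1) (s.reg 2) (s.reg 3) i := by
    simp only [Exp.eval]
    rw [h'.eval_adjExp (by omega) (by omega), h'.eval_adjExp (by omega) (by omega),
      h'.eval_adjExp (by omega) (by omega), e₁, e₂, e₃, hx, Majority]
    by_cases E (s.reg 1) i <;> by_cases E (s.reg 2) i <;> by_cases E (s.reg 3) i <;> simp [*]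
  simp only [Cmd.run, key]
  rcases Nat.lt_succ_iff_lt_or_eq.1 hj with hj | rfl
  · split_ifs <;>
      rw [Store.putArr_arr_self, Function.update_of_ne (by simp only [Exp.eval]; omega), ih j hj] <;>
      simp [*]
  · by_cases hm : Majority E (s.reg 1) (s.reg 2) (s.reg 3) j <;>
      simp [hm, Store.putArr_arr_self, Exp.eval, hx]

/-- Colors the vertex in register `7`, if it is uncolored, and that in register `6` is a neighbor
of color `0` or `1`. -/
def propagateCmd : Cmd :=
  .ite (adjExp 6 7)
    (.ite (.sub (.const 2) (.cell 2 (.reg 6)))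
      (.ite (.sub (.cell 2 (.reg 7)) (.const 2))
        (.put 2 (.reg 7) (.sub (.const 1) (.cell 2 (.reg 6)))) .skip) .skip) .skip

/-- Color `3` means uncolored. The two truncated differences in the tests are nonzero exactly for a
color below `2` and for color `3`, respectively. -/
theorem propagateCmd_run (h : Ready n E s) (h₆ : s.reg 6 < n) (h₇ : s.reg 7 < n) :
    (E (s.reg 6) (s.reg 7) ∧ s.arr 2 (s.reg 6) < 2 ∧ 2 < s.arr 2 (s.reg 7) ∧
      (propagateCmd.run s).arr 2 =
        Function.update (s.arr 2) (s.reg 7) (1 - s.arr 2 (s.reg 6))) ∨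
    (¬ (E (s.reg 6) (s.reg 7) ∧ s.arr 2 (s.reg 6) < 2 ∧ 2 < s.arr 2 (s.reg 7)) ∧
      (propagateCmd.run s).arr 2 = s.arr 2) := by
  classical
  simp only [propagateCmd, Cmd.run, h.eval_adjExp h₆ h₇, Exp.eval, ne_eq, ite_eq_right_iff,
    one_ne_zero, imp_false, not_not, Nat.sub_eq_zero_iff_le, not_le]
  split_ifs with h1 h2 h3
  · exact Or.inl ⟨h1, h2, h3, Store.putArr_arr_self⟩
  · exact Or.inr ⟨by tauto, rfl⟩
  · exact Or.inr ⟨by tauto, rfl⟩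
  · exact Or.inr ⟨by tauto, rfl⟩

/-- `f` is a proper coloring with `0` and `1` of the vertices outside `S`. -/
def IsBipartition (n : ℕ) (E : ℕ → ℕ → Prop) (S : ℕ → Prop) (f : ℕ → ℕ) : Prop :=
  (∀ i, f i < 2) ∧ ∀ i < n, ∀ j < n, E i j → ¬ S i → ¬ S j → f i ≠ f j

/-- The coloring `A` gives color `2` to `S`, and colors `0`, `1`, `3` to the other vertices. -/
def IsPartial (n : ℕ) (S : ℕ → Prop) (A : ℕ → ℕ) : Prop :=
  ∀ i < n, (A i = 2 ↔ S i) ∧ A i ≤ 3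

/-- The colors `0` and `1` of `A` are those of `f`. -/
def Agrees (n : ℕ) (f A : ℕ → ℕ) : Prop := ∀ i < n, A i < 2 → A i = f i

/-- The uncolored vertices have no neighbors of color `0` or `1`. -/
def IsClosed (n : ℕ) (E : ℕ → ℕ → Prop) (A : ℕ → ℕ) : Prop :=
  ∀ i < n, ∀ j < n, E i j → A i < 2 → A j ≤ 2

/-- `B` arises from `A` by coloring some of the uncolored vertices. -/
structure Extends (n : ℕ) (E : ℕ → ℕ → Prop) (S : ℕ → Prop) (A B : ℕ → ℕ) : Prop where
  eq : ∀ i < n, A i ≤ 2 → B i = A i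
  new : ∀ i < n, 2 < A i → B i = A i ∨ B i < 2
  agrees : ∀ f, IsBipartition n E S f → Agrees n f A → Agrees n f B

variable {S : ℕ → Prop} {A B C : ℕ → ℕ}

theorem Extends.refl : Extends n E S A A := ⟨fun _ _ _ => rfl, fun _ _ _ => .inl rfl, fun _ _ h => h⟩

theorem Extends.trans (h : Extends n E S A B) (h' : Extends n E S B C) : Extends n E S A C := by
  refine ⟨fun i hi hA => ?_, fun i hi hA => ?_, fun f hf hA => h'.agrees f hf (h.agrees f hf hA)⟩
  · have := h.eq i hi hA
    rw [h'.eq i hi (by omega), this]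
  · rcases h.new i hi hA with h1 | h1
    · rw [← h1]
      exact h'.new i hi (by omega)
    · right
      rw [h'.eq i hi (by omega)]
      exact h1

theorem Extends.isPartial (h : Extends n E S A B) (hA : IsPartial n S A) : IsPartial n S B := by
  intro i hi
  have h1 := hA i hi
  rw [← h1.1]
  rcases Nat.lt_or_ge 2 (A i) with h2 | h2
  · rcases h.new i hi h2 with h3 | h3 <;> omega
  · rw [h.eq i hi h2]; omega

/-- The new color is forced: `i` and `j` are adjacent outside `S`, so any bipartition that agrees
with `A` at `i` gives `j` the other color. -/
theorem extends_update (hA : IsPartial n S A) {i j : ℕ} (hi : i < n) (hj : j < n) (hij : E i j)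
    (h₁ : A i < 2) (h₂ : 2 < A j) : Extends n E S A (Function.update A j (1 - A i)) := by
  refine ⟨fun k _ hk => Function.update_of_ne (by rintro rfl; omega) .., fun k _ _ => ?_,
    fun f hf hfA k hk hlt => ?_⟩
  · by_cases h : k = j
    · subst h; right; rw [Function.update_self]; omega
    · left; exact Function.update_of_ne h ..
  · by_cases h : k = j
    · subst h
      rw [Function.update_self]
      have h3 := hf.2 i hi k hk hij (by rw [← (hA i hi).1]; omega) (by rw [← (hA k hk).1]; omega)
      have h4 := hf.1 i
      have h5 := hf.1 k
      have h6 := hfA i hi h₁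
      omega
    · rw [Function.update_of_ne h] at hlt ⊢
      exact hfA k hk hlt

/-- One round of propagation. -/
def roundCmd : Cmd := .loop 6 (.loop 7 propagateCmd)

/-- The last two clauses measure progress: a closed coloring is left alone, and otherwise every
uncolored neighbor of a vertex that had color `0` or `1` at the start receives a color. -/
theorem roundCmd_run (h : Ready n E s) (hS : IsPartial n S (s.arr 2)) :
    Extends n E S (s.arr 2) ((roundCmd.run s).arr 2) ∧
    (IsClosed n E (s.arr 2) → (roundCmd.run s).arr 2 = s.arr 2) ∧
    ∀ i < n, ∀ j < n, E i j → s.arr 2 i < 2 → (roundCmd.run s).arr 2 j ≤ 2 := by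
  rw [← h.reg_zero]
  rw [← h.reg_zero] at hS
  refine Cmd.run_loop_induction (by simp [Cmd.WellFormed, Cmd.vars, propagateCmd])
    (fun k M => Extends (s.reg 0) E S (s.arr 2) (M 2) ∧
      (IsClosed (s.reg 0) E (s.arr 2) → M 2 = s.arr 2) ∧
      ∀ i < k, ∀ j < s.reg 0, E i j → s.arr 2 i < 2 → M 2 j ≤ 2)
    ⟨.refl, fun _ => rfl, fun i hi => by omega⟩ fun k s' hk hx hr ha ih => ?_
  have hr0 := hr 0 (by omega) (by decide)
  have hr6 := hx
  have ha0 := ha 0 (by decide)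
  have ha3 := ha 3 (by decide)
  clear hr ha
  have := Cmd.run_loop_induction (x := 7) (p := propagateCmd) (s := s')
    (by simp [Cmd.WellFormed, Cmd.vars, propagateCmd])
    (fun k' M => Extends (s.reg 0) E S (s.arr 2) (M 2) ∧
      (IsClosed (s.reg 0) E (s.arr 2) → M 2 = s.arr 2) ∧
      (∀ i < k, ∀ j < s.reg 0, E i j → s.arr 2 i < 2 → M 2 j ≤ 2) ∧
      ∀ j < k', E k j → s.arr 2 k < 2 → M 2 j ≤ 2)
    ⟨ih.1, ih.2.1, ih.2.2, fun j hj => by omega⟩ ?_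
  · refine ⟨this.1, this.2.1, fun i hi j hj hij hlt => ?_⟩
    rcases Nat.lt_succ_iff_lt_or_eq.1 hi with hi | rfl
    · exact this.2.2.1 i hi j hj hij hlt
    · exact this.2.2.2 j (hr0 ▸ hj) hij hlt
  · rintro k' t hk' hx' hr' ha' ⟨ih1, ih2, ih3, ih4⟩
    have e0 := (hr' 0 (by omega) (by decide)).trans hr0
    have e6 := (hr' 6 (by omega) (by decide)).trans hr6
    have ht : Ready n E t := h.frame e0 ((ha' 0 (by decide)).trans ha0)
      ((ha' 3 (by decide)).trans ha3)
    have hn := h.reg_zero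
    rcases propagateCmd_run ht (by omega) (by omega) with ⟨p1, p2, p3, p4⟩ | ⟨p1, p2⟩
    · rw [p4]
      rw [e6, hx'] at *
      have hext := extends_update (ih1.isPartial hS) (by omega) (by omega) p1 p2 p3
      refine ⟨ih1.trans hext, fun hcl => ?_, fun i hi j hj hij hlt => ?_,
        fun j hj hij hlt => ?_⟩
      · rw [ih2 hcl] at p2 p3
        have := hcl _ (by omega) _ (by omega) p1 p2
        omega
      · have := ih3 i hi j hj hij hlt
        rw [hext.eq j (by omega) this]
        exact this
      · by_cases hjk : j = k'
        · subst hjk; rw [Function.update_self]; omega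
        · have := ih4 j (by omega) hij hlt
          rw [hext.eq j (by omega) this]
          exact this
    · rw [p2]
      refine ⟨ih1, ih2, ih3, fun j hj hij hlt => ?_⟩
      rcases Nat.lt_succ_iff_lt_or_eq.1 hj with hj | rfl
      · exact ih4 j hj hij hlt
      · rw [e6, hx'] at p1
        have := ih1.eq k (by omega) (by omega)
        by_contra hcon
        exact p1 ⟨hij, by omega, by omega⟩

/-- Propagates colors until nothing changes. -/
def propagateAllCmd : Cmd := .loop 5 roundCmd

/-- A round that starts from a coloring that is not closed colors a new vertex. So after `k` rounds
the coloring is closed or has at least `k` vertices of color `0` or `1`; for `k = n` these are all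
vertices, and it is closed in either case. -/
theorem propagateAllCmd_run (h : Ready n E s) (hS : IsPartial n S (s.arr 2)) :
    Extends n E S (s.arr 2) ((propagateAllCmd.run s).arr 2) ∧
      IsClosed n E ((propagateAllCmd.run s).arr 2) := by
  have key := Cmd.run_loop_induction (x := 5) (p := roundCmd) (s := s)
    (by simp [Cmd.WellFormed, Cmd.vars, propagateCmd, roundCmd])
    (fun k M => Extends n E S (s.arr 2) (M 2) ∧
      (IsClosed n E (M 2) ∨ k ≤ ((Finset.range n).filter (M 2 · < 2)).card))
    ⟨.refl, .inr (Nat.zero_le _)⟩ fun k t hk hx hr ha ih => ?_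
  · refine ⟨key.1, key.2.elim id fun hcard => ?_⟩
    rw [h.reg_zero] at hcard
    have hall := Finset.eq_of_subset_of_card_le (Finset.filter_subset _ _)
      (by rwa [Finset.card_range])
    intro i _ j hj _ _
    exact (Finset.mem_filter.1 (hall.symm ▸ Finset.mem_range.2 hj)).2.le
  · have ht : Ready n E t := h.frame (hr 0 (by decide) (by decide)) (ha 0 (by decide))
      (ha 3 (by decide))
    obtain ⟨h1, h2, h3⟩ := roundCmd_run ht (ih.1.isPartial hS)
    refine ⟨ih.1.trans h1, ?_⟩
    by_cases hcl : IsClosed n E (t.arr 2)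
    · left; rwa [h2 hcl]
    · right
      have hcard := ih.2.resolve_left hcl
      simp only [IsClosed, not_forall, not_le] at hcl
      obtain ⟨i, hi, j, hj, hij, hlt, hgt⟩ := hcl
      refine hcard.trans_lt (Finset.card_lt_card (Finset.ssubset_iff_of_subset ?_ |>.2 ?_))
      · intro m hm
        rw [Finset.mem_filter, Finset.mem_range] at hm ⊢
        rw [h1.eq m hm.1 (by omega)]
        exact hm
      · have hj2 := h3 i hi j hj hij hlt
        refine ⟨j, Finset.mem_filter.2 ⟨Finset.mem_range.2 hj, ?_⟩, fun hm => ?_⟩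
        · rcases h1.new j hj hgt with h | h <;> omega
        · have := (Finset.mem_filter.1 hm).2
          omega

/-- Gives color `0` to the vertex in register `4` if it is uncolored. -/
def seedCmd : Cmd := .ite (.sub (.cell 2 (.reg 4)) (.const 2)) (.put 2 (.reg 4) (.const 0)) .skip

/-- A closed partial coloring remains extendable if an uncolored vertex is given color `0`. -/
theorem exists_agrees_update (hE : ∀ i j, E i j → E j i) {A : ℕ → ℕ} (hA : IsPartial n S A)
    (hcl : IsClosed n E A) {k : ℕ} (hk : 2 < A k) {f : ℕ → ℕ} (hf : IsBipartition n E S f)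
    (hfA : Agrees n f A) : ∃ f, IsBipartition n E S f ∧ Agrees n f (Function.update A k 0) := by
  have hf2 := hf.1
  by_cases h0 : f k = 0
  · refine ⟨f, hf, fun i hi hlt => ?_⟩
    by_cases hik : i = k
    · subst hik; rw [Function.update_self, h0]
    · rw [Function.update_of_ne hik] at hlt ⊢
      exact hfA i hi hlt
  -- The bipartition is flipped on the vertices without color `0` or `1`. Closedness means that,
  -- outside `S`, no edge joins these to the colored ones.
  · refine ⟨fun i => if A i < 2 then f i else 1 - f i, ⟨fun i => ?_, fun i hi j hj hij h1 h2 => ?_⟩,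
      fun i hi hlt => ?_⟩
    · have := hf2 i
      dsimp only
      split_ifs <;> omega
    · have h3 := hf.2 i hi j hj hij h1 h2
      have h4 := hcl i hi j hj hij
      have h5 := hcl j hj i hi (hE i j hij)
      rw [← (hA i hi).1] at h1
      rw [← (hA j hj).1] at h2
      have h6 := hf2 i
      have h7 := hf2 j
      dsimp only
      split_ifs <;> omega
    · have := hf2 k
      by_cases hik : i = k
      · subst hik
        simp only [Function.update_self, if_neg (show ¬ A i < 2 by omega)]
        omega
      · rw [Function.update_of_ne hik] at hlt ⊢
        simp only [if_pos hlt]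
        exact hfA i hi hlt

/-- Colors the vertices outside `S`. -/
def colorCmd : Cmd := .loop 4 (.seq seedCmd propagateAllCmd)

/-- Seeding a new component with color `0` loses nothing, by `exists_agrees_update`, and propagation
makes only forced choices. Hence if a bipartition of the complement of `S` exists, some bipartition
always agrees with the current colors. -/
theorem colorCmd_run (hE : ∀ i j, E i j → E j i) (h : Ready n E s) (hS : IsPartial n S (s.arr 2))
    (h2 : ∀ i < n, 2 ≤ s.arr 2 i) :
    IsPartial n S ((colorCmd.run s).arr 2) ∧ (∀ i < n, (colorCmd.run s).arr 2 i ≤ 2) ∧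
      ((∃ f, IsBipartition n E S f) →
        ∃ f, IsBipartition n E S f ∧ Agrees n f ((colorCmd.run s).arr 2)) := by
  have key := Cmd.run_loop_induction (x := 4) (p := .seq seedCmd propagateAllCmd) (s := s)
    (by simp [Cmd.WellFormed, Cmd.vars, propagateCmd, roundCmd, propagateAllCmd, seedCmd])
    (fun k M => IsPartial n S (M 2) ∧ IsClosed n E (M 2) ∧ (∀ i < k, i < n → M 2 i ≤ 2) ∧
      ((∃ f, IsBipartition n E S f) → ∃ f, IsBipartition n E S f ∧ Agrees n f (M 2)))
    ⟨hS, fun i hi j hj _ hlt => by have := h2 i hi; omega, fun i hi => by omega,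
      fun ⟨f, hf⟩ => ⟨f, hf, fun i hi hlt => by have := h2 i hi; omega⟩⟩
    fun k t hk hx hr ha ih => ?_
  · exact ⟨key.1, fun i hi => key.2.2.1 i (by rwa [h.reg_zero]) hi, key.2.2.2⟩
  · obtain ⟨i1, i2, i3, i4⟩ := ih
    rw [h.reg_zero] at hk
    have ht : Ready n E t := h.frame (hr 0 (by decide) (by decide)) (ha 0 (by decide))
      (ha 3 (by decide))
    have hseed : IsPartial n S ((seedCmd.run t).arr 2) ∧
        (∀ i < k + 1, i < n → (seedCmd.run t).arr 2 i ≤ 2) ∧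
        ((∃ f, IsBipartition n E S f) →
          ∃ f, IsBipartition n E S f ∧ Agrees n f ((seedCmd.run t).arr 2)) := by
      by_cases hk2 : 2 < t.arr 2 k
      · have hrun : (seedCmd.run t).arr 2 = Function.update (t.arr 2) k 0 := by
          simp only [seedCmd, Cmd.run, Exp.eval, hx]
          rw [if_pos (by omega)]
          exact Store.putArr_arr_self
        rw [hrun]
        refine ⟨fun i hi => ?_, fun i hi hin => ?_, fun hex => ?_⟩
        · by_cases hik : i = k
          · subst hik
            rw [Function.update_self, ← (i1 i hi).1]
            omega
          · rw [Function.update_of_ne hik]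
            exact i1 i hi
        · by_cases hik : i = k
          · subst hik
            rw [Function.update_self]
            omega
          · rw [Function.update_of_ne hik]
            exact i3 i (by omega) hin
        · obtain ⟨f, hf, hfA⟩ := i4 hex
          exact exists_agrees_update hE i1 i2 hk2 hf hfA
      · have hrun : seedCmd.run t = t := by
          simp only [seedCmd, Cmd.run, Exp.eval, hx]
          rw [if_neg (by omega)]
        rw [hrun]
        refine ⟨i1, fun i hi hin => ?_, i4⟩
        rcases Nat.lt_succ_iff_lt_or_eq.1 hi with hi | rfl
        · exact i3 i hi hin
        · omega
    have hts : Ready n E (seedCmd.run t) :=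
      ht.frame (Cmd.run_reg (by decide)) (Cmd.run_arr (by decide)) (Cmd.run_arr (by decide))
    obtain ⟨p1, p2⟩ := propagateAllCmd_run hts hseed.1
    refine ⟨p1.isPartial hseed.1, p2, fun i hi hin => ?_, fun hex => ?_⟩
    · have := hseed.2.1 i hi hin
      exact (p1.eq i hin this).trans_le this
    · obtain ⟨f, hf, hfA⟩ := hseed.2.2 hex
      exact ⟨f, hf, p1.agrees f hf hfA⟩

/-- Adjacent vertices have different colors. -/
def IsProper (n : ℕ) (E : ℕ → ℕ → Prop) (A : ℕ → ℕ) : Prop :=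
  ∀ i < n, ∀ j < n, E i j → A i ≠ A j

/-- Compares the colors of two vertices. -/
def compareCmd : Cmd :=
  .ite (adjExp 5 6) (.ite (.add (.sub (.cell 2 (.reg 5)) (.cell 2 (.reg 6)))
    (.sub (.cell 2 (.reg 6)) (.cell 2 (.reg 5)))) .skip (.put 4 (.const 0) (.const 1))) .skip

/-- The sum of the two truncated differences vanishes exactly if the colors are equal. Cell `0` of
array `4` is a flag that is only ever raised here. -/
theorem compareCmd_run (h : Ready n E s) (h₅ : s.reg 5 < n) (h₆ : s.reg 6 < n) :
    (compareCmd.run s).arr 4 0 = 0 ↔ s.arr 4 0 = 0 ∧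
      (E (s.reg 5) (s.reg 6) → s.arr 2 (s.reg 5) ≠ s.arr 2 (s.reg 6)) := by
  classical
  by_cases h1 : E (s.reg 5) (s.reg 6)
  · rw [compareCmd, Cmd.run, if_pos (by rw [h.eval_adjExp h₅ h₆, if_pos h1]; exact one_ne_zero)]
    by_cases h2 : s.arr 2 (s.reg 5) = s.arr 2 (s.reg 6)
    · rw [Cmd.run, if_neg (by simp [Exp.eval, h2]), Cmd.run, Store.putArr_arr_self]
      simp [Exp.eval, h1, h2]
    · rw [Cmd.run, if_pos (by simp only [Exp.eval]; omega)]
      simp [Cmd.run, h2]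
  · rw [compareCmd, Cmd.run, if_neg (by rw [h.eval_adjExp h₅ h₆, if_neg h1]; simp)]
    simp [Cmd.run, h1]

/-- Writes `0` into cell `0` of array `4` if and only if the coloring in array `2` is proper. -/
def checkCmd : Cmd := .seq (.put 4 (.const 0) (.const 0)) (.loop 5 (.loop 6 compareCmd))

theorem checkCmd_run (h : Ready n E s) :
    (checkCmd.run s).arr 4 0 = 0 ↔ IsProper n E (s.arr 2) := by
  set s₀ := (Cmd.put 4 (.const 0) (.const 0)).run s with hs₀
  have hr₀ : Ready n E s₀ :=
    h.frame (Cmd.run_reg (by decide)) (Cmd.run_arr (by decide)) (Cmd.run_arr (by decide))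
  have h2 : s₀.arr 2 = s.arr 2 := Cmd.run_arr (by decide)
  have key := Cmd.run_loop_induction (x := 5) (p := .loop 6 compareCmd) (s := s₀)
    (by simp [Cmd.WellFormed, Cmd.vars, compareCmd])
    (fun k M => M 4 0 = 0 ↔ ∀ i < k, ∀ j < n, E i j → s.arr 2 i ≠ s.arr 2 j)
    (by simp [hs₀, Cmd.run, Store.putArr, Exp.eval]) fun k t hk hx hr ha ih => ?_
  · rw [hr₀.reg_zero] at key
    exact key
  · have ht : Ready n E t := hr₀.frame (hr 0 (by decide) (by decide)) (ha 0 (by decide))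
      (ha 3 (by decide))
    rw [hr₀.reg_zero] at hk
    have ht2 : t.arr 2 = s.arr 2 := (ha 2 (by decide)).trans h2
    have key := Cmd.run_loop_induction (x := 6) (p := compareCmd) (s := t)
      (by simp [Cmd.WellFormed, Cmd.vars, compareCmd])
      (fun k' M => M 4 0 = 0 ↔ (∀ i < k, ∀ j < n, E i j → s.arr 2 i ≠ s.arr 2 j) ∧
        ∀ j < k', E k j → s.arr 2 k ≠ s.arr 2 j)
      (by simpa using ih) fun k' u hk' hx' hr' ha' ih' => ?_
    · rw [ht.reg_zero] at key
      rw [key]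
      constructor
      · rintro ⟨h1, h3⟩ i hi
        rcases Nat.lt_succ_iff_lt_or_eq.1 hi with hi | rfl
        · exact h1 i hi
        · exact h3
      · exact fun h => ⟨fun i hi => h i (by omega), h k (by omega)⟩
    · have hu : Ready n E u := ht.frame (hr' 0 (by decide) (by decide)) (ha' 0 (by decide))
        (ha' 3 (by decide))
      have hu5 : u.reg 5 = k := (hr' 5 (by decide) (by decide)).trans hx
      have hu2 : u.arr 2 = s.arr 2 := (ha' 2 (by decide)).trans ht2
      rw [ht.reg_zero] at hk'
      rw [compareCmd_run hu (by omega) (by omega), ih', hu5, hx', hu2, and_assoc]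
      refine and_congr_right fun _ => ⟨fun h j hj => ?_, fun h => ⟨fun j hj => h j (by omega),
        h k' (by omega)⟩⟩
      rcases Nat.lt_succ_iff_lt_or_eq.1 hj with hj | rfl
      · exact h.1 j hj
      · exact h.2

/-- Copies array `2` into array `1` if cell `0` of array `4` is `0`. -/
def copyCmd : Cmd :=
  .ite (.cell 4 (.const 0)) .skip (.loop 5 (.put 1 (.reg 5) (.cell 2 (.reg 5))))

theorem copyCmd_run_of_ne_zero (h : s.arr 4 0 ≠ 0) : copyCmd.run s = s := by
  simp [copyCmd, Cmd.run, Exp.eval, h]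

theorem copyCmd_run_of_eq_zero (h : s.arr 4 0 = 0) :
    ∀ i < s.reg 0, (copyCmd.run s).arr 1 i = s.arr 2 i := by
  have hrun : copyCmd.run s = (Cmd.loop 5 (.put 1 (.reg 5) (.cell 2 (.reg 5)))).run s := by
    rw [copyCmd, Cmd.run, if_neg (by simp [Exp.eval, h])]
  rw [hrun]
  refine Cmd.run_loop_induction (by simp [Cmd.WellFormed, Cmd.vars])
    (fun k M => ∀ i < k, M 1 i = s.arr 2 i) (fun i hi => by omega)
    fun k t hk hx hr ha ih i hi => ?_
  rw [Cmd.run, Store.putArr_arr_self]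
  simp only [Exp.eval, hx, ha 2 (by decide)]
  rcases Nat.lt_succ_iff_lt_or_eq.1 hi with hi | rfl
  · rw [Function.update_of_ne (by omega), ih i hi]
  · rw [Function.update_self]

/-- Array `A` holds a proper 3-coloring. -/
def IsColoring (n : ℕ) (E : ℕ → ℕ → Prop) (A : ℕ → ℕ) : Prop :=
  (∀ i < n, A i < 3) ∧ IsProper n E A

/-- The majority set is independent and its complement bipartite. -/
def IsSplit (n : ℕ) (E : ℕ → ℕ → Prop) (a b c : ℕ) : Prop :=
  (∀ i < n, ∀ j < n, E i j → ¬ (Majority E a b c i ∧ Majority E a b c j)) ∧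
    ∃ f, IsBipartition n E (Majority E a b c) f

/-- Tries the majority set of the registers `1`, `2`, `3` as a color class. -/
def attemptCmd : Cmd := .seq initCmd (.seq colorCmd (.seq checkCmd copyCmd))

/-- Array `1` is overwritten only by a coloring that has passed the check. Unsuitable triples are
therefore harmless, and a coloring once found can be replaced only by another one. -/
theorem attemptCmd_run (hE : ∀ i j, E i j → E j i) (h : Ready n E s) (h₁ : s.reg 1 < n)
    (h₂ : s.reg 2 < n) (h₃ : s.reg 3 < n)
    (hs : IsSplit n E (s.reg 1) (s.reg 2) (s.reg 3) ∨ IsColoring n E (s.arr 1)) :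
    IsColoring n E ((attemptCmd.run s).arr 1) := by
  classical
  have e₁ := initCmd_run h h₁ h₂ h₃
  set S := Majority E (s.reg 1) (s.reg 2) (s.reg 3)
  set s₁ := initCmd.run s with hs₁
  have r₁ : Ready n E s₁ :=
    h.frame (Cmd.run_reg (by decide)) (Cmd.run_arr (by decide)) (Cmd.run_arr (by decide))
  obtain ⟨c₁, c₂, c₃⟩ := colorCmd_run hE r₁ (S := S)
    (fun i hi => by rw [e₁ i hi]; split_ifs with hi <;> simp [hi])
    (fun i hi => by rw [e₁ i hi]; split_ifs <;> omega)
  set s₂ := colorCmd.run s₁ with hs₂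
  have r₂ : Ready n E s₂ :=
    r₁.frame (Cmd.run_reg (by decide)) (Cmd.run_arr (by decide)) (Cmd.run_arr (by decide))
  have k₁ := checkCmd_run r₂
  set s₃ := checkCmd.run s₂ with hs₃
  have hrun : attemptCmd.run s = copyCmd.run s₃ := rfl
  have a₁ : s₃.arr 1 = s.arr 1 := by
    rw [hs₃, Cmd.run_arr (by decide), hs₂, Cmd.run_arr (by decide), hs₁, Cmd.run_arr (by decide)]
  have a₂ : s₃.arr 2 = s₂.arr 2 := Cmd.run_arr (by decide)
  have a₀ : s₃.reg 0 = n := (Cmd.run_reg (by decide)).trans r₂.reg_zero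
  rw [hrun]
  by_cases h4 : s₃.arr 4 0 = 0
  · have hcopy := copyCmd_run_of_eq_zero h4
    rw [a₀, a₂] at hcopy
    refine ⟨fun i hi => ?_, fun i hi j hj hij => ?_⟩
    · rw [hcopy i hi]
      exact Nat.lt_succ_of_le (c₂ i hi)
    · rw [hcopy i hi, hcopy j hj]
      exact k₁.1 h4 i hi j hj hij
  · rw [copyCmd_run_of_ne_zero h4, a₁]
    -- For a suitable triple the check cannot fail: the majority set is independent, and the other
    -- colors agree with a bipartition of the rest.
    refine hs.resolve_left fun hsp => h4 (k₁.2 fun i hi j hj hij heq => ?_)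
    obtain ⟨f, hf, hfA⟩ := c₃ hsp.2
    have hnot := hsp.1 i hi j hj hij
    have hi2 := c₂ i hi
    have hi3 := c₁ i hi
    have hj3 := c₁ j hj
    by_cases hSi : S i
    · exact hnot ⟨hSi, hj3.1.1 (heq ▸ hi3.1.2 hSi)⟩
    · have hSj : ¬ S j := fun h => hSi (hi3.1.1 (heq ▸ hj3.1.2 h))
      have hi4 : s₂.arr 2 i ≠ 2 := fun h => hSi (hi3.1.1 h)
      refine hf.2 i hi j hj hij hSi hSj ?_
      rw [← hfA i hi (by omega), ← hfA j hj (by omega), heq]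

/-- Computes the starts of the rows of the adjacency matrix. -/
def rowsCmd : Cmd :=
  .loop 1 (.seq (.put 3 (.reg 1) (.cell 4 (.const 1)))
    (.put 4 (.const 1) (.add (.cell 4 (.const 1)) (.reg 0))))

/-- The machine cannot multiply, so the row starts are built by repeated addition, with the running
sum in cell `1` of array `4`. -/
theorem rowsCmd_run (h : s.arr 4 1 = 0) :
    ∀ i < s.reg 0, (rowsCmd.run s).arr 3 i = s.reg 0 * i := by
  have key := Cmd.run_loop_induction (x := 1) (p := .seq (.put 3 (.reg 1) (.cell 4 (.const 1)))
    (.put 4 (.const 1) (.add (.cell 4 (.const 1)) (.reg 0)))) (s := s)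
    (by simp [Cmd.WellFormed, Cmd.vars])
    (fun k M => M 4 1 = s.reg 0 * k ∧ ∀ i < k, M 3 i = s.reg 0 * i)
    ⟨by simpa using h, fun i hi => by omega⟩ fun k t hk hx hr ha ih => ?_
  · exact key.2
  · have h0 := hr 0 (by decide) (by decide)
    simp only [Cmd.run, Exp.eval, Store.putArr, hx, h0]
    refine ⟨by simp [ih.1, mul_add], fun i hi => ?_⟩
    rcases Nat.lt_succ_iff_lt_or_eq.1 hi with hi | rfl
    · simp [Function.update_of_ne hi.ne, ih.2 i hi]
    · simp [ih.1]

/-- The coloring algorithm. -/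
def mainCmd : Cmd := .seq rowsCmd (.loop 1 (.loop 2 (.loop 3 attemptCmd)))

theorem mainCmd_wellFormed : mainCmd.WellFormed := by
  simp [Cmd.WellFormed, Cmd.vars, mainCmd, rowsCmd, attemptCmd, initCmd, colorCmd, checkCmd,
    copyCmd, compareCmd, seedCmd, propagateAllCmd, roundCmd, propagateCmd]

/-- The invariant is that array `1` holds a coloring once the triple `(a, b, c)` has been passed in
lexicographic order. -/
theorem loop_attemptCmd_run (hE : ∀ i j, E i j → E j i) (h : Ready n E s) {a b c : ℕ}
    (ha : a < n) (hb : b < n) (hc : c < n) (hs : IsSplit n E a b c) :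
    IsColoring n E (((Cmd.loop 1 (.loop 2 (.loop 3 attemptCmd))).run s).arr 1) := by
  have hwf := mainCmd_wellFormed.2
  have key := Cmd.run_loop_induction hwf (s := s)
    (fun k M => a < k → IsColoring n E (M 1)) (fun h => by omega) fun k t hk hx hr hf ih hak => ?_
  · exact key (by rwa [h.reg_zero])
  have ht : Ready n E t := h.frame (hr 0 (by decide) (by decide)) (hf 0 (by decide))
    (hf 3 (by decide))
  rw [h.reg_zero] at hk
  -- Here `a ≤ k` by `hak`, so the invariant for `b < k'` only concerns the round `k = a` and later
  -- ones.
  have key := Cmd.run_loop_induction hwf.2.2 (s := t)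
    (fun k' M => a < k ∨ b < k' → IsColoring n E (M 1)) (fun h => ih (by omega))
    fun k' t' hk' hx' hr' hf' ih' hak' => ?_
  · exact key (.inr (by rwa [ht.reg_zero]))
  have ht' : Ready n E t' := ht.frame (hr' 0 (by decide) (by decide)) (hf' 0 (by decide))
    (hf' 3 (by decide))
  have hx1 : t'.reg 1 = k := (hr' 1 (by decide) (by decide)).trans hx
  rw [ht.reg_zero] at hk'
  have key := Cmd.run_loop_induction hwf.2.2.2.2 (s := t')
    (fun k'' M => (a < k ∨ b < k') ∨ c < k'' → IsColoring n E (M 1))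
    (fun h => ih' (by omega)) fun k'' u hk'' hx'' hr'' hf'' ih'' hak'' => ?_
  · exact key (.inr (by rwa [ht'.reg_zero]))
  have hu : Ready n E u := ht'.frame (hr'' 0 (by decide) (by decide)) (hf'' 0 (by decide))
    (hf'' 3 (by decide))
  have hu1 : u.reg 1 = k := (hr'' 1 (by decide) (by decide)).trans hx1
  have hu2 : u.reg 2 = k' := (hr'' 2 (by decide) (by decide)).trans hx'
  rw [ht'.reg_zero] at hk''
  refine attemptCmd_run hE hu (by omega) (by omega) (by omega) ?_
  by_cases hdone : (a < k ∨ b < k') ∨ c < k''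
  · exact .inr (ih'' hdone)
  · left
    rw [hu1, hu2, hx'', show k = a by omega, show k' = b by omega, show k'' = c by omega]
    exact hs

/-! ### From the memory of the machine back to graphs -/

open SimpleGraph

theorem polyTime_mainCmd : mainCmd.toProgram.PolyTime := by
  refine ⟨mainCmd.timeBound, fun n G => ?_⟩
  obtain ⟨t, h, ht⟩ := Cmd.exec mainCmd_wellFormed (input G)
  exact ⟨t, _, h, ht⟩

/-- Adjacency in terms of the numbers of the vertices. -/
def NumAdj {n : ℕ} (G : SimpleGraph (Fin n)) (i j : ℕ) : Prop :=
  ∃ u v : Fin n, (u : ℕ) = i ∧ (v : ℕ) = j ∧ G.Adj u v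

theorem numAdj_iff {n : ℕ} {G : SimpleGraph (Fin n)} {u v : Fin n} :
    NumAdj G u v ↔ G.Adj u v := by
  refine ⟨?_, fun h => ⟨u, v, rfl, rfl, h⟩⟩
  rintro ⟨u', v', hu, hv, h⟩
  rwa [Fin.ext hu, Fin.ext hv] at h

theorem ready_rowsCmd_run {n : ℕ} (G : SimpleGraph (Fin n)) :
    Ready n (NumAdj G) (rowsCmd.run (input G)) := by
  classical
  have hreg : (rowsCmd.run (input G)).reg 0 = n := Cmd.run_reg (by decide)
  refine ⟨hreg, fun i hi j hj => ?_⟩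
  have hrow := rowsCmd_run (s := input G) (by simp [input]) i hi
  have harr : (rowsCmd.run (input G)).arr 0 = (input G).arr 0 := Cmd.run_arr (by decide)
  rw [harr, hrow]
  have hiff : (∃ u v : Fin n, (input G).reg 0 * i + j = n * u + v ∧ G.Adj u v) ↔
      NumAdj G i j := by
    constructor
    · rintro ⟨u, v, h, huv⟩
      replace h : n * i + j = n * u + v := h
      have hn : 0 < n := by omega
      have h1 : i = u := by
        have := congrArg (· / n) h
        simpa [Nat.mul_add_div hn, Nat.div_eq_of_lt hj, Nat.div_eq_of_lt v.2] using this
      subst h1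
      exact ⟨u, v, rfl, by omega, huv⟩
    · rintro ⟨u, v, rfl, rfl, huv⟩
      exact ⟨u, v, rfl, huv⟩
  simp only [input, true_and]
  exact if_congr hiff rfl rfl

theorem majority_numAdj_iff {n : ℕ} {G : SimpleGraph (Fin n)} {a b c w : Fin n} :
    Majority (NumAdj G) a b c w ↔ G.InMajority a b c w := by
  simp only [Majority, InMajority, numAdj_iff]

theorem isSplit_of_splits {n : ℕ} {G : SimpleGraph (Fin n)} {a b c : Fin n}
    (h : G.Splits a b c) : IsSplit n (NumAdj G) a b c := by
  obtain ⟨f, hf⟩ := h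
  constructor
  · rintro _ - _ - ⟨u, v, rfl, rfl, huv⟩
    rw [majority_numAdj_iff, majority_numAdj_iff]
    exact (hf u v huv).1
  · refine ⟨fun i => if h : i < n then (f ⟨i, h⟩).toNat else 0, fun i => ?_, ?_⟩
    · dsimp only
      split_ifs
      · exact Bool.toNat_lt _
      · omega
    · rintro _ - _ - ⟨u, v, rfl, rfl, huv⟩ h1 h2
      rw [majority_numAdj_iff] at h1 h2
      have := (hf u v huv).2 h1 h2
      simp only [Fin.is_lt, dite_true, Fin.eta]
      revert this
      cases f u <;> cases f v <;> simp

/-- The splitting triple is not part of the input: it is transported to the numbering `e` only for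
the proof, and the program meets it among all triples. -/
theorem colors_of_splits {V : Type*} {G : SimpleGraph V} {a b c : V} (h : G.Splits a b c) :
    mainCmd.toProgram.Colors 3 G := by
  intro n e
  obtain ⟨t, ht, -⟩ := Cmd.exec mainCmd_wellFormed (input (G.comap e))
  refine ⟨t, _, ht, ?_⟩
  have hs : (G.comap e).Splits (e.symm a) (e.symm b) (e.symm c) := by
    obtain ⟨f, hf⟩ := h
    refine ⟨fun v => f (e v), fun v w hvw => ?_⟩
    have := hf (e v) (e w) hvw
    simpa only [InMajority, comap_adj, Equiv.apply_symm_apply] using this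
  have hcol := loop_attemptCmd_run (E := NumAdj (G.comap e))
    (fun i j ⟨u, v, hu, hv, huv⟩ => ⟨v, u, hv, hu, huv.symm⟩)
    (ready_rowsCmd_run (G.comap e)) (e.symm a).2 (e.symm b).2 (e.symm c).2 (isSplit_of_splits hs)
  refine ⟨Coloring.mk (fun v => ⟨_, hcol.1 (e.symm v) (e.symm v).2⟩) fun {v w} hvw => ?_,
    fun i => ?_⟩
  · intro heq
    refine hcol.2 _ (e.symm v).2 _ (e.symm w).2 ?_ (Fin.mk.inj_iff.1 heq)
    rw [numAdj_iff]
    simpa using hvw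
  · change _ = (((mainCmd.run (input (G.comap e))).arr 1 (e.symm (e i))) : ℕ)
    rw [Equiv.symm_apply_apply]

end RAM

/-! ### Conclusion -/

namespace SimpleGraph

theorem Splits.colorable {V : Type*} {G : SimpleGraph V} {a b c : V} (h : G.Splits a b c) :
    G.Colorable 3 := by
  classical
  obtain ⟨f, hf⟩ := h
  refine ⟨Coloring.mk
    (fun v => if G.InMajority a b c v then (2 : Fin 3) else if f v then 1 else 0)
    fun {v w} hvw => ?_⟩
  have := hf v w hvw
  by_cases h1 : G.InMajority a b c v <;> by_cases h2 : G.InMajority a b c w <;>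
    cases h3 : f v <;> cases h4 : f w <;> simp_all

end SimpleGraph

open SimpleGraph in
theorem mainTheorem8 :
    ∃ A : RAM.Program, A.PolyTime ∧
      ∀ (V : Type*) [Finite V] (G : SimpleGraph V), G.Connected →
        ¬ P2UnionP4.IsIndContained G → ¬ paw.IsIndContained G →
          (G.HasComparablePair
            ∨ G = ⊤
            ∨ (groetzsch.IsIndContained G ∧ G.IsIndContained clebsch ∧ G.chromaticNumber = 4)
            ∨ (G.chromaticNumber ≤ 3 ∧ A.Colors 3 G))
          ∧ (G.chromaticNumber ≤ 3 → A.Colors 3 G) := by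

  refine ⟨RAM.mainCmd.toProgram, RAM.polyTime_mainCmd, fun V _ G hc hP hpaw => ?_⟩
  have hle : G.chromaticNumber ≤ 3 ↔ G.Colorable 3 := chromaticNumber_le_iff_colorable
  rw [hle]
  by_cases htri : ∃ a b c, G.Adj a b ∧ G.Adj b c ∧ G.Adj a c
  · obtain ⟨a, b, c, hab, hbc, hac⟩ := htri
    have htr : ∀ {u v w}, ¬ G.Adj u v → ¬ G.Adj v w → ¬ G.Adj u w :=
      fun h₁ h₂ => not_adj_trans hc hpaw hab hbc hac h₁ h₂
    refine ⟨?_, fun hcol => RAM.colors_of_splits (splits_of_colorable htr hab hbc hac hcol)⟩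
    rcases hasComparablePair_or_eq_top htr with h | h
    · exact .inl h
    · exact .inr (.inl h)
  · have hG : G.IsTriangleP2P4Free := isTriangleP2P4Free_of_not_isIndContained
      (fun hab hbc hac => htri ⟨_, _, _, hab, hbc, hac⟩) hP
    rcases hG.groetzsch_or_splits hc with hF | ⟨a, b, c, hs⟩
    · refine ⟨?_, fun hcol => ?_⟩
      · by_cases hcomp : G.HasComparablePair
        · exact .inl hcomp
        · have hcl := hG.isIndContained_clebsch hc hF hcomp
          exact .inr (.inr (.inl ⟨hF, hcl, chromaticNumber_eq_four hF hcl⟩))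
      -- With an induced Grötzsch graph `G` is not 3-colorable, so the claim about the algorithm is
      -- vacuous.
      · obtain ⟨e⟩ := hF
        exact absurd (hcol.of_hom e.toHom) not_colorable_groetzsch
    · exact ⟨.inr (.inr (.inr ⟨hs.colorable, RAM.colors_of_splits hs⟩)),
        fun _ => RAM.colors_of_splits hs⟩
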